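/- **Setting.** Let $\mathcal X,\mathcal Y$ be measurable spaces, $\mathcal Z=\mathcal X\times\mathcal Y$, let $L:\mathcal Y\times\mathcal Y\to[0,\infty)$ be a loss, $H$ a set of hypotheses $h:\mathcal X\to\mathcal Y$, and let $\mathcal F=\{(x,y)\mapsto L(h(x),y): h\in H\}$. Assume $|f|\le M$ for all $f\in\mathcal F$, and that $\mathcal F$ is a measurable class: each $f\in\mathcal F$ is measurable and, for all $n$ and $a\in\mathbb R^n$, the map $(z_1,\dots,z_n)\mapsto\sup_{f\in\mathcal F}\sum_i a_if(z_i)$ is universally measurable. Let $Z_1,\dots,Z_{T+1}$ be $\mathcal Z$-valued random variables with an arbitrary joint distribution, admitting regular conditional distributions $\mathbf p_t(\cdot\mid z_1^{t-1})$ of $Z_t$ given $Z_1^{t-1}=z_1^{t-1}$; write $\mathbb E[f(Z_t)\mid Z_1^{t-1}]=\int f\,d\mathbf p_t(\cdot\mid Z_1^{t-1})$. Let $q\in\mathbb R^T$ be an arbitrary weight vector, let $1\le s\le T$, and let $p\in\mathbb R^T$ be the uniform distribution over the last $s$ points, i.e. $p_t=1/s$ for $T-s<t\le T$ and $p_t=0$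 otherwise. Define $$\widetilde{\mathrm{disc}}(q)=\sup_{f\in\mathcal F}\sum_{t=1}^T(p_t-q_t)f(Z_t),\qquad \mathrm{disc}_s=\sup_{f\in\mathcal F}\Big(\mathbb E[f(Z_{T+1})\mid Z_1^T]-\frac1s\sum_{t=T-s+1}^T\mathbb E[f(Z_t)\mid Z_1^{t-1}]\Big).$$ **Covering numbers.** An $A$-valued tree of depth $T$ is a sequence $\mathbf z=(z_1,\dots,z_T)$ of maps $z_t:\{\pm1\}^{t-1}\to A$; write $z_t(\sigma)=z_t(\sigma_1,\dots,\sigma_{t-1})$. For $w\in\mathbb R^T$, $\alpha>0$ and a $\mathcal Z$-valued tree $\mathbf z$, let $\mathcal N_1^{w}(\alpha,\mathcal F,\mathbf z)$ be the least cardinality of a set $V$ of $\mathbb R$-valued trees such that for all $f\in\mathcal F$ and $\sigma\in\{\pm1\}^T$ there is $\mathbf v\in V$ with $\|w\|_\infty\sum_{t=1}^T|v_t(\sigma)-f(z_t(\sigma))|\le\alpha$. Let $T(\mathbf p)$ be the law of the following random tree $\mathbf z$: at every node, reached by $\sigma_1,\dots,\sigma_{t-1}$, draw independent $Z_t,Z_t'$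 from $\mathbf p_t(\cdot\mid S_1(\sigma_1),\dots,S_{t-1}(\sigma_{t-1}))$, where $S_i(1)=Z_i$ and $S_i(-1)=Z_i'$ are the samples drawn at the $i$-th node on the path, with draws in different subtrees conditionally independent; $\mathbf z$ is formed by the $Z_t$'s. Put $$N(\alpha)=\max\Big\{\mathbb E_{\mathbf z\sim T(\mathbf p)}\big[\mathcal N_1^{q}(\alpha,\mathcal F,\mathbf z)\big],\ \mathbb E_{\mathbf z\sim T(\mathbf p)}\big[\mathcal N_1^{q-p}(\alpha,\mathcal F,\mathbf z)\big]\Big\}$$ (equivalently, the expected size of a minimal $\alpha$-cover with respect to both weight vectors $q$ and $q-p$). **Corollary.** For every $\delta>0$, with probability at least $1-\delta$, the following holds simultaneously for all $f\in\mathcal F$ and all $\alpha>0$: $$\mathbb E[f(Z_{T+1})\mid Z_1^T]\le\sum_{t=1}^Tq_tf(Z_t)+\widetilde{\mathrm{disc}}(q)+\mathrm{disc}_s+4\alpha+M\big(\|q\|_2+\|q-p\|_2\big)\sqrt{2\log\frac{2N(\alpha)}{\delta}},$$ where the right-hand side is $+\infty$ if $N(\alpha)=\infty$. -/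

import Mathlib

open MeasureTheory ProbabilityTheory

namespace Forecast

/-! ### The loss class -/

/-- The family `ℱ = {(x, y) ↦ L (h x) y : h ∈ H}`. -/
def lossClass {𝒳 𝒴 : Type*} (L : 𝒴 → 𝒴 → ℝ) (H : Set (𝒳 → 𝒴)) : Set (𝒳 × 𝒴 → ℝ) :=
  {f | ∃ h ∈ H, f = fun z => L (h z.1) z.2}

/-- `ℱ` is a (universally) measurable class: its members are measurable, and so are, on the
completion of every probability measure, all the suprema of weighted sums
`(z₁, …, zₙ) ↦ sup_{f ∈ ℱ} ∑ᵢ aᵢ f(zᵢ)`. Every uniformly bounded countable family of measurable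
functions has this property. -/
def IsMeasurableClass {𝒵 : Type*} [MeasurableSpace 𝒵] (ℱ : Set (𝒵 → ℝ)) : Prop :=
  (∀ f ∈ ℱ, Measurable f) ∧
    ∀ (n : ℕ) (a : Fin n → ℝ) (ν : Measure (Fin n → 𝒵)) [IsProbabilityMeasure ν],
      AEMeasurable (fun z : Fin n → 𝒵 => ⨆ f : ℱ, ∑ i, a i * f.1 (z i)) ν

/-! ### Complete binary trees and sequential covering numbers -/

/-- A complete binary tree of depth `n` with values in `A`: a sequence of maps
`z t : {±1}^t → A`, for `t = 0, …, n - 1`. The sign `+1` is encoded by `true` and the sign `-1`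
by `false`. -/
abbrev Tree (A : Type*) (n : ℕ) : Type _ := (t : Fin n) → (Fin t → Bool) → A

/-- The value at level `t` of the tree `z` along the path `σ`; it depends only on the signs of `σ`
with index smaller than `t`. -/
def Tree.along {A : Type*} {n : ℕ} (z : Tree A n) (σ : Fin n → Bool) (t : Fin n) : A :=
  z t fun i => σ ⟨i, i.2.trans t.2⟩

/-- `V` is a sequential `α`-cover of `𝒢` on the tree `z` with respect to the `w`-weighted `ℓ₁` norm:
for all `g ∈ 𝒢` and all paths `σ` there is `v ∈ V` with
`∑ₜ |vₜ(σ) - g(zₜ(σ))| ≤ α / ‖w‖_∞`, where `‖·‖_∞` is the norm dual to the `ℓ₁` norm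
(the norm of `Fin n → ℝ` in Mathlib is the sup norm; the inequality is multiplied out, so that
it is void for `w = 0`). -/
def IsSeqCover {A : Type*} {n : ℕ} (w : Fin n → ℝ) (α : ℝ) (𝒢 : Set (A → ℝ)) (z : Tree A n)
    (V : Set (Tree ℝ n)) : Prop :=
  ∀ g ∈ 𝒢, ∀ σ : Fin n → Bool, ∃ v ∈ V,
    ‖w‖ * ∑ t, |v.along σ t - g (z.along σ t)| ≤ α

/-- The sequential covering number `𝒩₁(α, 𝒢, z)` with respect to the weights `w`: the least
cardinality of a sequential `α`-cover (possibly infinite). -/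
noncomputable def seqCoveringNumber {A : Type*} {n : ℕ} (w : Fin n → ℝ) (α : ℝ)
    (𝒢 : Set (A → ℝ)) (z : Tree A n) : ℕ∞ :=
  ⨅ V ∈ {V : Set (Tree ℝ n) | IsSeqCover w α 𝒢 z V}, V.encard

/-! ### The random tree sampled from the process -/

section RandomTree

variable {𝒵 : Type*} [MeasurableSpace 𝒵]

/-- The tree with the value `a.1` at the root, the tree `a.2.1` below the sign `+1` and the tree
`a.2.2` below the sign `-1`. -/
def graft {A : Type*} {n : ℕ} (a : A × Tree A n × Tree A n) : Tree A (n + 1) :=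
  fun t => match t with
    | ⟨0, _⟩ => fun _ => a.1
    | ⟨k + 1, hk⟩ => fun τ =>
        (if τ 0 = true then a.2.1 else a.2.2) ⟨k, Nat.lt_of_succ_lt_succ hk⟩ fun i => τ i.succ

lemma measurable_graft {A : Type*} [MeasurableSpace A] {n : ℕ} :
    Measurable (graft : A × Tree A n × Tree A n → Tree A (n + 1)) := by
  refine measurable_pi_lambda _ fun t => measurable_pi_lambda _ fun τ => ?_
  rcases t with ⟨_ | k, hk⟩
  · exact measurable_fst
  · by_cases h : τ 0 = true
    · simp only [graft, h, if_true]
      fun_prop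
    · simp only [graft, h, if_false, Bool.false_eq_true]
      fun_prop

lemma measurable_snoc {B : Type*} [MeasurableSpace B] {t : ℕ} {u : B → Fin t → 𝒵} {v : B → 𝒵}
    (hu : Measurable u) (hv : Measurable v) :
    Measurable fun b => (Fin.snoc (u b) (v b) : Fin (t + 1) → 𝒵) := by
  refine measurable_pi_lambda _ fun i => ?_
  refine Fin.lastCases ?_ (fun j => ?_) i
  · simpa using hv
  · simpa using measurable_pi_iff.1 hu j

/-- Given a past `z₁, …, z_t`, the law of the random tree of pairs `(Z, Z')` of depth `n`: two
independent samples `Z, Z'` are drawn from `p t (z₁, …, z_t)` and put at the root; independently of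
each other, the subtree below the sign `+1` is then drawn in the same way given the past
`z₁, …, z_t, Z`, and the subtree below the sign `-1` given the past `z₁, …, z_t, Z'`. -/
noncomputable def pairTreeKernel (p : (t : ℕ) → Kernel (Fin t → 𝒵) 𝒵) :
    (n t : ℕ) → Kernel (Fin t → 𝒵) (Tree (𝒵 × 𝒵) n)
  | 0, _ => Kernel.const _ (Measure.dirac fun i => i.elim0)
  | n + 1, t =>
    ((p t ×ₖ p t) ⊗ₖ
      ((pairTreeKernel p n (t + 1)).comap
          (fun b : (Fin t → 𝒵) × 𝒵 × 𝒵 => (Fin.snoc b.1 b.2.1 : Fin (t + 1) → 𝒵))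
          (measurable_snoc measurable_fst measurable_snd.fst) ×ₖ
        (pairTreeKernel p n (t + 1)).comap
          (fun b : (Fin t → 𝒵) × 𝒵 × 𝒵 => (Fin.snoc b.1 b.2.2 : Fin (t + 1) → 𝒵))
          (measurable_snoc measurable_fst measurable_snd.snd))).map graft

/-- The law `T(p)` of the random `𝒵`-valued tree `z` of depth `n` formed by the first components
`Z` of the random tree of pairs `(Z, Z')`. -/
noncomputable def treeLaw (p : (t : ℕ) → Kernel (Fin t → 𝒵) 𝒵) (n : ℕ) : Measure (Tree 𝒵 n) :=
  (pairTreeKernel p n 0 fun i => i.elim0).map fun z t τ => (z t τ).1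

/-- The expected sequential covering number `𝔼_{z ∼ T(p)} [𝒩₁(α, 𝒢, z)]` with respect to the
weights `w`. -/
noncomputable def expectedCoveringNumber (p : (t : ℕ) → Kernel (Fin t → 𝒵) 𝒵) {n : ℕ}
    (w : Fin n → ℝ) (α : ℝ) (𝒢 : Set (𝒵 → ℝ)) : ENNReal :=
  ∫⁻ z, (seqCoveringNumber w α 𝒢 z : ENNReal) ∂(treeLaw p n)

end RandomTree

/-! ### The process, its conditional means and its discrepancies

Times are numbered from `0`: the observations `Z₁, …, Z_T` are `Z 0, …, Z (T - 1)`, and `Z T` is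
the value to be forecast. -/

section TimeSeries

variable {Ω 𝒵 : Type*} [MeasurableSpace Ω] [MeasurableSpace 𝒵]

/-- The past `(Z 0, …, Z (t - 1))` of the process at time `t`. -/
def past (Z : ℕ → Ω → 𝒵) (t : ℕ) (ω : Ω) : Fin t → 𝒵 := fun i => Z i ω

/-- The values `Z 0, …, Z T` of the process are distributed according to `p`: `p t` is the (regular)
conditional distribution of `Z t` given the past `Z 0, …, Z (t - 1)`. -/
def IsDistributedAccordingTo (μ : Measure Ω) (Z : ℕ → Ω → 𝒵)
    (p : (t : ℕ) → Kernel (Fin t → 𝒵) 𝒵) (T : ℕ) : Prop :=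
  ∀ t ≤ T, HasCondDistrib (Z t) (past Z t) (p t) μ

/-- The conditional mean `𝔼[f(Z t) | Z 0, …, Z (t - 1)]`, computed for all `f` from the same
regular conditional distribution. -/
noncomputable def condMean (p : (t : ℕ) → Kernel (Fin t → 𝒵) 𝒵) (Z : ℕ → Ω → 𝒵) (f : 𝒵 → ℝ)
    (t : ℕ) (ω : Ω) : ℝ :=
  ∫ z, f z ∂(p t (past Z t ω))

/-- `condMean` is a version of the conditional expectation given the past. -/
lemma condMean_ae_eq_condExp (μ : Measure Ω) [IsProbabilityMeasure μ] (Z : ℕ → Ω → 𝒵) (T : ℕ)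
    (hZ : ∀ t ≤ T, Measurable (Z t)) (p : (t : ℕ) → Kernel (Fin t → 𝒵) 𝒵) [∀ t, IsMarkovKernel (p t)]
    (hp : IsDistributedAccordingTo μ Z p T) (f : 𝒵 → ℝ) (hf : Measurable f) (M : ℝ)
    (hM : ∀ z, |f z| ≤ M) (t : ℕ) (ht : t ≤ T) :
    condMean p Z f t =ᵐ[μ]
      μ[fun ω => f (Z t ω) | MeasurableSpace.comap (past Z t) inferInstance] := by
  have hpast : Measurable (past Z t) := measurable_pi_lambda _ fun i => hZ i (i.2.le.trans ht)
  have hg : StronglyMeasurable fun h => ∫ z, f z ∂(p t h) :=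
    (hf.stronglyMeasurable).integral_kernel
  have hb : ∀ h, ‖∫ z, f z ∂(p t h)‖ ≤ M := fun h => by
    refine (norm_integral_le_of_norm_le_const (C := M) (.of_forall hM)).trans ?_
    simp
  have hif : Integrable (fun ω => f (Z t ω)) μ :=
    Integrable.of_bound (hf.comp (hZ t ht)).aestronglyMeasurable M
        (.of_forall fun _ => hM _)
  symm
  refine (ae_eq_condExp_of_forall_setIntegral_eq hpast.comap_le hif ?_ ?_ ?_).symm
  · intro s hs _
    exact (Integrable.of_bound (hg.comp_measurable hpast).aestronglyMeasurable M
        (.of_forall fun _ => hb _)).integrableOn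
  · rintro _ ⟨A, hA, rfl⟩ -
    have h1 := (hp t ht).map_eq
    have e1 : ∫ ω in past Z t ⁻¹' A, f (Z t ω) ∂μ
        = ∫ x in A ×ˢ Set.univ, f x.2 ∂(μ.map fun ω => (past Z t ω, Z t ω)) := by
      rw [setIntegral_map (hA.prod .univ) (show Measurable fun x : (Fin t → 𝒵) × 𝒵 => f x.2 from
        hf.comp measurable_snd).aestronglyMeasurable
        (hpast.prodMk (hZ t ht)).aemeasurable]
      congr 2
      ext; simp
    rw [e1, h1, Measure.setIntegral_compProd hA .univ]
    · simp only [condMean, Measure.restrict_univ]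
      rw [setIntegral_map hA hg.aestronglyMeasurable hpast.aemeasurable]
    · have := Measure.isProbabilityMeasure_map (μ := μ) hpast.aemeasurable
      exact (Integrable.of_bound (hf.comp measurable_snd).aestronglyMeasurable M
        (.of_forall fun _ => hM _)).integrableOn
  · exact (hg.comp_measurable (comap_measurable _)).aestronglyMeasurable

/-- The uniform distribution over the last `s` of the `T` sample points. -/
noncomputable def lastUniform (T s : ℕ) (t : Fin T) : ℝ :=
  if T ≤ (t : ℕ) + s then 1 / (s : ℝ) else 0

/-- `disc_s = sup_{f ∈ ℱ} (𝔼[f(Z T) | past] - (1/s) ∑_{last s times t} 𝔼[f(Z t) | past])`. -/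
noncomputable def discLast (p : (t : ℕ) → Kernel (Fin t → 𝒵) 𝒵) (Z : ℕ → Ω → 𝒵)
    (ℱ : Set (𝒵 → ℝ)) (T s : ℕ) (ω : Ω) : ℝ :=
  ⨆ f : ℱ, (condMean p Z f.1 T ω - ∑ t : Fin T, lastUniform T s t * condMean p Z f.1 t ω)

/-- The empirical discrepancy `sup_{f ∈ ℱ} ∑ₜ (pₜ - qₜ) f(Zₜ)`, where `p` is the uniform
distribution over the last `s` points. -/
noncomputable def empiricalDisc (Z : ℕ → Ω → 𝒵) (ℱ : Set (𝒵 → ℝ)) {T : ℕ} (s : ℕ)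
    (q : Fin T → ℝ) (ω : Ω) : ℝ :=
  ⨆ f : ℱ, ∑ t : Fin T, (lastUniform T s t - q t) * f.1 (Z t ω)

/-- The Euclidean norm of a weight vector. -/
noncomputable def l2norm {T : ℕ} (w : Fin T → ℝ) : ℝ := √(∑ t, w t ^ 2)

end TimeSeries

end Forecast

/-! Write `w` for the uniform weights on the last `s` points. The definitions of the two suprema
alone bound the forecast by the first three terms plus the martingale term `∑ t, w t * (condMean p Z
f t ω - f (Z t ω))` (`condMean_le_discrepancies`). So everything reduces to bounding this term
uniformly over the class.

A Chernoff bound does this. Each conditional mean is the mean of `f` at an independent tangent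
sample, so Jensen's inequality replaces conditional means by tangent values
(`exp_sum_condMean_sub_le`). The process with its tangent sequence has the law of a random path in
the tree of pairs (`lintegral_tangent_eq_lintegral_swapPath`), where exchanging the two samples at a
node amounts to flipping a sign. AM-GM separates the two samples, and the mirror symmetry of the
tree law makes the two halves equal (`sum_lintegral_swapPath_le`). On a fixed tree, a sum over a
cover replaces the supremum, and each cover element has a sub-Gaussian moment
(`sum_exp_iSup_le_seqCoveringNumber`).

Losses lie in `[0, M]`; centring them at `M / 2` halves the sup bound and offsets the factor 2 lost
in AM-GM. The weights `q` and `q - w` enter only through triangle inequalities: `‖w‖ ≤ 2 * max ‖q‖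
‖q - w‖`, which doubles the scale of the cover, and `l2norm w ≤ l2norm q + l2norm (q - w)`.
Uniformity in `α` costs no union bound, because the exceptional events for different `α` are nested
(`exists_measurableSet_forall_le`). -/

namespace Forecast

/-! ### Paths in the tree of pairs, and the decoupled tangent sequence -/

section Symmetrization

variable {𝒵 : Type*} [MeasurableSpace 𝒵]

instance isMarkovKernel_pairTreeKernel (p : (t : ℕ) → Kernel (Fin t → 𝒵) 𝒵)
    [∀ t, IsMarkovKernel (p t)] (n t : ℕ) : IsMarkovKernel (pairTreeKernel p n t) := by
  induction n generalizing t with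
  | zero => unfold pairTreeKernel; infer_instance
  | succ n ih =>
    have := ih (t + 1)
    unfold pairTreeKernel
    exact Kernel.IsMarkovKernel.map _ measurable_graft

lemma lintegral_pairTreeKernel_succ (p : (t : ℕ) → Kernel (Fin t → 𝒵) 𝒵)
    [∀ t, IsMarkovKernel (p t)] (n t : ℕ) (h : Fin t → 𝒵) {φ : Tree (𝒵 × 𝒵) (n + 1) → ENNReal}
    (hφ : Measurable φ) :
    ∫⁻ τ, φ τ ∂(pairTreeKernel p (n + 1) t h) =
      ∫⁻ x, ∫⁻ y, ∫⁻ l, ∫⁻ r, φ (graft ((x, y), l, r))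
        ∂(pairTreeKernel p n (t + 1) (Fin.snoc h y))
        ∂(pairTreeKernel p n (t + 1) (Fin.snoc h x)) ∂(p t h) ∂(p t h) := by
  have hg : Measurable fun a : (𝒵 × 𝒵) × Tree (𝒵 × 𝒵) n × Tree (𝒵 × 𝒵) n => φ (graft a) :=
    hφ.comp measurable_graft
  rw [pairTreeKernel, Kernel.lintegral_map _ measurable_graft _ hφ,
    Kernel.lintegral_compProd _ _ _ hg]
  have hm (K : Kernel ((Fin t → 𝒵) × 𝒵 × 𝒵) (Tree (𝒵 × 𝒵) n × Tree (𝒵 × 𝒵) n))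
      [IsMarkovKernel K] : Measurable fun a => ∫⁻ b, φ (graft (a, b)) ∂(K (h, a)) :=
    hg.lintegral_kernel_prod_right' (κ := K.comap (Prod.mk h) measurable_prodMk_left)
  refine (Kernel.lintegral_prod _ _ _ (hm _)).trans ?_
  refine lintegral_congr fun x => lintegral_congr fun y => ?_
  exact Kernel.lintegral_prod _ _ _ (hg.comp measurable_prodMk_left)

/-- The path of pairs selected by the signs `σ`, with the pairs at the signs `-1` swapped, so that
the first components are the samples that the tree continues with. -/
def swapPath {A : Type*} {n : ℕ} (τ : Tree (A × A) n) (σ : Fin n → Bool) (t : Fin n) : A × A :=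
  if σ t = true then τ.along σ t else (τ.along σ t).swap

lemma measurable_swapPath {n : ℕ} (σ : Fin n → Bool) :
    Measurable fun τ : Tree (𝒵 × 𝒵) n => swapPath τ σ := by
  refine measurable_pi_lambda _ fun t => ?_
  unfold swapPath Tree.along
  split_ifs
  · fun_prop
  · exact measurable_swap.comp (by fun_prop)

lemma swapPath_graft {A : Type*} {n : ℕ} (a : A × A) (l r : Tree (A × A) n) (b : Bool)
    (σ : Fin n → Bool) :
    swapPath (graft (a, l, r)) (Fin.cons b σ : Fin (n + 1) → Bool) =
      (Fin.cons (if b = true then a else a.swap) (swapPath (if b = true then l else r) σ) :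
        Fin (n + 1) → A × A) := by
  funext t
  refine Fin.cases ?_ (fun i => ?_) t
  · cases b <;> rfl
  · cases b <;> rfl

lemma sum_bool_cons {M : Type*} [AddCommMonoid M] {n : ℕ} (F : (Fin (n + 1) → Bool) → M) :
    ∑ σ, F σ = ∑ σ : Fin n → Bool, F (Fin.cons true σ) +
      ∑ σ : Fin n → Bool, F (Fin.cons false σ) := by
  rw [← (Fin.consEquiv fun _ : Fin (n + 1) => Bool).sum_comp F, Fintype.sum_prod_type]
  simp [Fin.consEquiv]

lemma sum_bool_snoc {M : Type*} [AddCommMonoid M] {n : ℕ} (F : (Fin (n + 1) → Bool) → M) :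
    ∑ σ, F σ = ∑ σ : Fin n → Bool, (F (Fin.snoc σ true) + F (Fin.snoc σ false)) := by
  rw [← (Fin.snocEquiv fun _ : Fin (n + 1) => Bool).sum_comp F, Fintype.sum_prod_type_right]
  simp [Fin.snocEquiv]

/-- The root sign decides which of two i.i.d. samples the path continues with. Renaming them makes
both signs contribute equally, whence the factor 2. -/
lemma lintegral_sum_swapPath_succ (p : (t : ℕ) → Kernel (Fin t → 𝒵) 𝒵)
    [∀ t, IsMarkovKernel (p t)] (n t : ℕ) (h : Fin t → 𝒵)
    {ψ : (Fin (n + 1) → 𝒵 × 𝒵) → ENNReal} (hψ : Measurable ψ) :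
    ∫⁻ τ, ∑ σ, ψ (swapPath τ σ) ∂(pairTreeKernel p (n + 1) t h) =
      2 * ∫⁻ x, ∫⁻ y, ∫⁻ τ, ∑ σ, ψ (Fin.cons (x, y) (swapPath τ σ))
        ∂(pairTreeKernel p n (t + 1) (Fin.snoc h x)) ∂(p t h) ∂(p t h) := by
  have hcons : Measurable fun a : (𝒵 × 𝒵) × (Fin n → 𝒵 × 𝒵) =>
      (Fin.cons a.1 a.2 : Fin (n + 1) → 𝒵 × 𝒵) := by
    refine measurable_pi_lambda _ fun i => ?_
    refine Fin.cases ?_ (fun j => ?_) i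
    · simpa using measurable_fst
    · simpa using measurable_pi_iff.1 measurable_snd j
  have hF : Measurable fun a : (𝒵 × 𝒵) × Tree (𝒵 × 𝒵) n =>
      ∑ σ, ψ (Fin.cons a.1 (swapPath a.2 σ)) := by
    refine Finset.measurable_sum _ fun σ _ => hψ.comp ?_
    exact hcons.comp (measurable_fst.prodMk ((measurable_swapPath σ).comp measurable_snd))
  have hFa (a : 𝒵 × 𝒵) : Measurable fun τ : Tree (𝒵 × 𝒵) n =>
      ∑ σ, ψ (Fin.cons a (swapPath τ σ)) := hF.comp measurable_prodMk_left
  have hG : Measurable fun a : 𝒵 × 𝒵 => ∫⁻ τ, ∑ σ, ψ (Fin.cons a (swapPath τ σ))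
        ∂(pairTreeKernel p n (t + 1) (Fin.snoc h a.1)) :=
    hF.lintegral_kernel_prod_right' (κ := (pairTreeKernel p n (t + 1)).comap
      (fun a : 𝒵 × 𝒵 => (Fin.snoc h a.1 : Fin (t + 1) → 𝒵))
      (measurable_snoc measurable_const measurable_fst))
  have hG' := hG.comp measurable_swap
  rw [lintegral_pairTreeKernel_succ]
  · have key (x y : 𝒵) : ∫⁻ l, ∫⁻ r, ∑ σ, ψ (swapPath (graft ((x, y), l, r)) σ)
        ∂(pairTreeKernel p n (t + 1) (Fin.snoc h y))
        ∂(pairTreeKernel p n (t + 1) (Fin.snoc h x)) =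
        ∫⁻ τ, ∑ σ, ψ (Fin.cons (x, y) (swapPath τ σ))
          ∂(pairTreeKernel p n (t + 1) (Fin.snoc h x)) +
        ∫⁻ τ, ∑ σ, ψ (Fin.cons (y, x) (swapPath τ σ))
          ∂(pairTreeKernel p n (t + 1) (Fin.snoc h y)) := by
      simp only [sum_bool_cons, swapPath_graft, if_true, if_false, Bool.false_eq_true,
        Prod.swap_prod_mk]
      simp_rw [lintegral_add_left measurable_const]
      simp only [lintegral_const, measure_univ, mul_one]
      rw [lintegral_add_right _ measurable_const]
      simp
    simp_rw [key]
    have e1 (x : 𝒵) := lintegral_add_left (μ := p t h) (hG.comp (measurable_prodMk_left (x := x)))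
      fun y => ∫⁻ τ, ∑ σ, ψ (Fin.cons (y, x) (swapPath τ σ))
          ∂(pairTreeKernel p n (t + 1) (Fin.snoc h y))
    simp only [Function.comp_def] at e1
    simp_rw [e1]
    rw [lintegral_add_left hG.lintegral_prod_right',
      lintegral_lintegral_swap (f := fun x y => ∫⁻ τ, ∑ σ, ψ (Fin.cons (y, x) (swapPath τ σ))
          ∂(pairTreeKernel p n (t + 1) (Fin.snoc h y))) hG'.aemeasurable, two_mul]
  · exact Finset.measurable_sum _ fun σ _ => hψ.comp (measurable_swapPath σ)

/-- The law of a decoupled tangent sequence: given `z₁, …, z_n`, the values `z'ₜ` are independent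
and `z'ₜ` is drawn from `p t (z₁, …, z_{t-1})`. -/
noncomputable def tangentKernel (p : (t : ℕ) → Kernel (Fin t → 𝒵) 𝒵) :
    (n : ℕ) → Kernel (Fin n → 𝒵) (Fin n → 𝒵)
  | 0 => Kernel.const _ (Measure.dirac fun i => i.elim0)
  | n + 1 => ((tangentKernel p n ×ₖ p n).comap (fun z : Fin (n + 1) → 𝒵 => Fin.init z)
      (by unfold Fin.init; fun_prop)).map
        fun a => (Fin.snoc a.1 a.2 : Fin (n + 1) → 𝒵)

instance isMarkovKernel_tangentKernel (p : (t : ℕ) → Kernel (Fin t → 𝒵) 𝒵)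
    [∀ t, IsMarkovKernel (p t)] (n : ℕ) : IsMarkovKernel (tangentKernel p n) := by
  induction n with
  | zero => unfold tangentKernel; infer_instance
  | succ n ih =>
    unfold tangentKernel
    exact Kernel.IsMarkovKernel.map _ (measurable_snoc measurable_fst measurable_snd)

lemma lintegral_tangentKernel_succ (p : (t : ℕ) → Kernel (Fin t → 𝒵) 𝒵)
    [∀ t, IsMarkovKernel (p t)] (n : ℕ) (z : Fin (n + 1) → 𝒵) {φ : (Fin (n + 1) → 𝒵) → ENNReal}
    (hφ : Measurable φ) :
    ∫⁻ w, φ w ∂(tangentKernel p (n + 1) z) =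
      ∫⁻ w, ∫⁻ y, φ (Fin.snoc w y) ∂(p n (Fin.init z)) ∂(tangentKernel p n (Fin.init z)) := by
  have hs : Measurable fun a : (Fin n → 𝒵) × 𝒵 => (Fin.snoc a.1 a.2 : Fin (n + 1) → 𝒵) :=
    measurable_snoc measurable_fst measurable_snd
  rw [tangentKernel, Kernel.lintegral_map _ hs _ hφ, Kernel.lintegral_comap]
  exact Kernel.lintegral_prod _ _ _ (hφ.comp hs)

/-- Only the first `t` observations enter the law of the `t`-th tangent value. Hence the mean of `f`
at that value is exactly `condMean`. -/
lemma map_eval_tangentKernel (p : (t : ℕ) → Kernel (Fin t → 𝒵) 𝒵)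
    [∀ t, IsMarkovKernel (p t)] {Ω : Type*} (Z : ℕ → Ω → 𝒵) (ω : Ω) (n : ℕ) (t : Fin n) :
    (tangentKernel p n (past Z n ω)).map (fun w => w t) = p t (past Z t ω) := by
  refine Measure.ext_of_lintegral _ fun g hg => ?_
  rw [lintegral_map hg (measurable_pi_apply t)]
  induction n with
  | zero => exact t.elim0
  | succ n ih =>
    have hinit : Fin.init (past Z (n + 1) ω) = past Z n ω := rfl
    rw [lintegral_tangentKernel_succ _ _ _ (φ := fun a => g (a t))
      (hg.comp (measurable_pi_apply t)), hinit]
    refine Fin.lastCases ?_ (fun j => ?_) t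
    · simp
    · simpa using ih j

end Symmetrization

/-! ### Identification of the laws, and the mirror symmetry of the tree -/

section Tangent

variable {Ω 𝒵 : Type*} [MeasurableSpace Ω] [MeasurableSpace 𝒵]

/-- The concatenation of two finite sequences with lengths `t + n = T`. -/
def glue {A : Type*} {T t n : ℕ} (h : t + n = T) (u : Fin t → A) (v : Fin n → A) (i : Fin T) : A :=
  if hi : (i : ℕ) < t then u ⟨i, hi⟩ else v ⟨i - t, by omega⟩

lemma glue_cons {A : Type*} {T t n : ℕ} (h : t + (n + 1) = T) (h' : t + 1 + n = T) (u : Fin t → A)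
    (a : A) (v : Fin n → A) :
    glue h u (Fin.cons a v : Fin (n + 1) → A) = glue h' (Fin.snoc u a : Fin (t + 1) → A) v := by
  funext i
  unfold glue
  rcases lt_trichotomy (i : ℕ) t with hi | hi | hi
  · rw [dif_pos hi, dif_pos (by omega)]
    exact (Fin.snoc_castSucc (α := fun _ => A) a u ⟨i, hi⟩).symm
  · rw [dif_neg (by omega), dif_pos (by omega)]
    have e1 : (⟨i - t, by omega⟩ : Fin (n + 1)) = 0 := Fin.ext (by simp [hi])
    have e2 : (⟨i, by omega⟩ : Fin (t + 1)) = Fin.last t := Fin.ext hi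
    rw [e1, e2]
    simp
  · rw [dif_neg (by omega), dif_neg (by omega)]
    have e1 : (⟨i - t, by omega⟩ : Fin (n + 1)) = Fin.succ ⟨i - (t + 1), by omega⟩ :=
      Fin.ext (by simp; omega)
    rw [e1, Fin.cons_succ]

lemma measurable_glue {A : Type*} [MeasurableSpace A] {T t n : ℕ} (h : t + n = T) :
    Measurable fun a : (Fin t → A) × (Fin n → A) => glue h a.1 a.2 := by
  refine measurable_pi_lambda _ fun i => ?_
  unfold glue
  split_ifs
  · exact measurable_pi_iff.1 measurable_fst _
  · exact measurable_pi_iff.1 measurable_snd _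

/-- The sequence of pairs formed by two sequences. -/
def zipPair {A : Type*} {t : ℕ} (a : (Fin t → A) × (Fin t → A)) (i : Fin t) : A × A :=
  (a.1 i, a.2 i)

lemma measurable_zipPair {t : ℕ} :
    Measurable (zipPair : (Fin t → 𝒵) × (Fin t → 𝒵) → Fin t → 𝒵 × 𝒵) := by
  refine measurable_pi_lambda _ fun i => ?_
  exact (measurable_pi_iff.1 measurable_fst i).prodMk (measurable_pi_iff.1 measurable_snd i)

lemma zipPair_snoc {A : Type*} {t : ℕ} (u w : Fin t → A) (x y : A) :
    zipPair ((Fin.snoc u x : Fin (t + 1) → A), (Fin.snoc w y : Fin (t + 1) → A)) =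
      (Fin.snoc (zipPair (u, w)) (x, y) : Fin (t + 1) → A × A) := by
  funext i
  refine Fin.lastCases ?_ (fun j => ?_) i <;> simp [zipPair]

lemma measurable_past {Z : ℕ → Ω → 𝒵} {T : ℕ} (hZ : ∀ t ≤ T, Measurable (Z t)) {t : ℕ}
    (ht : t ≤ T) : Measurable (past Z t) :=
  measurable_pi_lambda _ fun i => hZ i (i.2.le.trans ht)

lemma past_succ {Ω 𝒵 : Type*} (Z : ℕ → Ω → 𝒵) (t : ℕ) (ω : Ω) :
    past Z (t + 1) ω = (Fin.snoc (past Z t ω) (Z t ω) : Fin (t + 1) → 𝒵) := by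
  funext i
  refine Fin.lastCases ?_ (fun j => ?_) i <;> simp [past]

lemma lintegral_past_succ {μ : Measure Ω} [IsProbabilityMeasure μ] {Z : ℕ → Ω → 𝒵} {T : ℕ}
    (hZ : ∀ t ≤ T, Measurable (Z t)) {p : (t : ℕ) → Kernel (Fin t → 𝒵) 𝒵}
    [∀ t, IsMarkovKernel (p t)] (hp : IsDistributedAccordingTo μ Z p T) {t : ℕ} (ht : t ≤ T)
    {φ : (Fin (t + 1) → 𝒵) → ENNReal} (hφ : Measurable φ) :
    ∫⁻ ω, φ (past Z (t + 1) ω) ∂μ =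
      ∫⁻ ω, ∫⁻ x, φ (Fin.snoc (past Z t ω) x) ∂(p t (past Z t ω)) ∂μ := by
  have hpast := measurable_past hZ ht
  have hs : Measurable fun a : (Fin t → 𝒵) × 𝒵 => φ (Fin.snoc a.1 a.2) :=
    hφ.comp (measurable_snoc measurable_fst measurable_snd)
  simp_rw [past_succ]
  rw [← lintegral_map (f := fun a : (Fin t → 𝒵) × 𝒵 => φ (Fin.snoc a.1 a.2))
    (g := fun ω => (past Z t ω, Z t ω)) hs (hpast.prodMk (hZ t ht)), (hp t ht).map_eq,
    Measure.lintegral_compProd hs, lintegral_map hs.lintegral_kernel_prod_right' hpast]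

/-- The process together with a decoupled tangent sequence has the law of a path of the random
tree of pairs, with uniformly distributed signs. -/
lemma lintegral_tangent_eq_lintegral_swapPath {μ : Measure Ω} [IsProbabilityMeasure μ]
    {Z : ℕ → Ω → 𝒵} {T : ℕ} (hZ : ∀ t ≤ T, Measurable (Z t))
    {p : (t : ℕ) → Kernel (Fin t → 𝒵) 𝒵} [∀ t, IsMarkovKernel (p t)]
    (hp : IsDistributedAccordingTo μ Z p T) {φ : (Fin T → 𝒵 × 𝒵) → ENNReal} (hφ : Measurable φ) :
    2 ^ T * ∫⁻ ω, ∫⁻ w, φ (zipPair (past Z T ω, w)) ∂(tangentKernel p T (past Z T ω)) ∂μ =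
      ∫⁻ τ, ∑ σ, φ (swapPath τ σ) ∂(pairTreeKernel p T 0 fun i => i.elim0) := by
  -- Interpolation: the first `t` pairs come from the process and its tangent sequence, the
  -- remaining `n` from a tree started at the past. Each step trades one pair and one factor 2.
  have main : ∀ n t : ℕ, ∀ h : t + n = T,
      2 ^ n * ∫⁻ ω, ∫⁻ w, φ (zipPair (past Z T ω, w)) ∂(tangentKernel p T (past Z T ω)) ∂μ =
        ∫⁻ ω, ∫⁻ w, ∫⁻ τ, ∑ σ, φ (glue h (zipPair (past Z t ω, w)) (swapPath τ σ))
          ∂(pairTreeKernel p n t (past Z t ω)) ∂(tangentKernel p t (past Z t ω)) ∂μ := by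
    intro n
    induction n with
    | zero =>
      rintro t rfl
      have hg (u : Fin t → 𝒵 × 𝒵) (v : Fin 0 → 𝒵 × 𝒵) : glue (T := t + 0) rfl u v = u := by
        funext i
        simp [glue]
      simp [hg]
    | succ n ih =>
      intro t h
      have h' : t + 1 + n = T := by omega
      have htT : t ≤ T := by omega
      have hF : Measurable fun a : ((Fin (t + 1) → 𝒵) × (Fin (t + 1) → 𝒵)) × Tree (𝒵 × 𝒵) n =>
          ∑ σ, φ (glue h' (zipPair a.1) (swapPath a.2 σ)) := by
        refine Finset.measurable_sum _ fun σ _ => hφ.comp ?_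
        exact (measurable_glue h').comp ((measurable_zipPair.comp measurable_fst).prodMk
          ((measurable_swapPath σ).comp measurable_snd))
      have hG : Measurable fun a : (Fin (t + 1) → 𝒵) × (Fin (t + 1) → 𝒵) =>
          ∫⁻ τ, ∑ σ, φ (glue h' (zipPair a) (swapPath τ σ)) ∂(pairTreeKernel p n (t + 1) a.1) :=
        hF.lintegral_kernel_prod_right'
          (κ := (pairTreeKernel p n (t + 1)).comap Prod.fst measurable_fst)
      rw [pow_succ', mul_assoc, ih (t + 1) h', lintegral_past_succ hZ hp htT
        (φ := fun z => ∫⁻ w, ∫⁻ τ, ∑ σ, φ (glue h' (zipPair (z, w)) (swapPath τ σ))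
          ∂(pairTreeKernel p n (t + 1) z) ∂(tangentKernel p (t + 1) z))
        hG.lintegral_kernel_prod_right', ← lintegral_const_mul' _ _ (by simp)]
      refine lintegral_congr fun ω => ?_
      set z := past Z t ω
      have hg (u : Fin t → 𝒵 × 𝒵) : Measurable fun v : Fin (n + 1) → 𝒵 × 𝒵 => glue h u v :=
        (measurable_glue h).comp measurable_prodMk_left
      have hR : ∀ w, ∫⁻ τ, ∑ σ, φ (glue h (zipPair (z, w)) (swapPath τ σ))
          ∂(pairTreeKernel p (n + 1) t z) = 2 * ∫⁻ x, ∫⁻ y, ∫⁻ τ, ∑ σ,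
            φ (glue h' (zipPair ((Fin.snoc z x : Fin (t + 1) → 𝒵),
              (Fin.snoc w y : Fin (t + 1) → 𝒵)))
              (swapPath τ σ))
          ∂(pairTreeKernel p n (t + 1) (Fin.snoc z x)) ∂(p t z) ∂(p t z) := by
        intro w
        rw [lintegral_sum_swapPath_succ p n t z
          (ψ := fun v => φ (glue h (zipPair (z, w)) v))
          (hφ.comp (hg (zipPair (z, w))))]
        simp_rw [glue_cons h h', zipPair_snoc]
      have hm : Measurable fun a : ((Fin t → 𝒵) × 𝒵) × 𝒵 => ∫⁻ τ, ∑ σ,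
          φ (glue h' (zipPair ((Fin.snoc z a.1.2 : Fin (t + 1) → 𝒵),
            (Fin.snoc a.1.1 a.2 : Fin (t + 1) → 𝒵))) (swapPath τ σ))
          ∂(pairTreeKernel p n (t + 1) (Fin.snoc z a.1.2)) :=
        hG.comp ((measurable_snoc measurable_const (by fun_prop)).prodMk
          (measurable_snoc (by fun_prop) measurable_snd))
      simp_rw [hR]
      -- Given `z`, the earlier tangent values and the next sample are independent, so either may be
      -- drawn first.
      rw [lintegral_const_mul' _ _ (by simp), lintegral_lintegral_swap]
      · congr 1
        refine lintegral_congr fun x => ?_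
        refine (lintegral_tangentKernel_succ _ _ _ (hG.comp measurable_prodMk_left)).trans ?_
        have : Fin.init (Fin.snoc z x : Fin (t + 1) → 𝒵) = z := Fin.init_snoc _ _
        rw [this]
        rfl
      · exact hm.lintegral_prod_right'.aemeasurable
  rw [main T 0 (Nat.zero_add T)]
  have hg (u : Fin 0 → 𝒵 × 𝒵) (v : Fin T → 𝒵 × 𝒵) : glue (Nat.zero_add T) u v = v := by
    funext i
    simp [glue]
  have h0 (ω : Ω) : past Z 0 ω = fun i => i.elim0 := funext fun i => i.elim0
  simp [hg, h0]

/-- Exchanging the two samples and the two subtrees at every node. -/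
def mirror {A : Type*} : {n : ℕ} → Tree (A × A) n → Tree (A × A) n :=
  fun τ t s => (τ t fun i => !(s i)).swap

lemma measurable_mirror {n : ℕ} : Measurable (mirror : Tree (𝒵 × 𝒵) n → Tree (𝒵 × 𝒵) n) := by
  refine measurable_pi_lambda _ fun t => measurable_pi_lambda _ fun s => ?_
  exact measurable_swap.comp (by fun_prop)

lemma mirror_graft {A : Type*} {n : ℕ} (a : A × A) (l r : Tree (A × A) n) :
    mirror (graft (a, l, r)) = graft (a.swap, mirror r, mirror l) := by
  funext t s
  rcases t with ⟨_ | k, hk⟩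
  · rfl
  · simp only [mirror, graft]
    cases s 0 <;> rfl

/-- The law of the random tree of pairs is invariant under the exchange of the two samples. -/
lemma lintegral_mirror_pairTreeKernel (p : (t : ℕ) → Kernel (Fin t → 𝒵) 𝒵)
    [∀ t, IsMarkovKernel (p t)] (n t : ℕ) (h : Fin t → 𝒵) {φ : Tree (𝒵 × 𝒵) n → ENNReal}
    (hφ : Measurable φ) :
    ∫⁻ τ, φ (mirror τ) ∂(pairTreeKernel p n t h) = ∫⁻ τ, φ τ ∂(pairTreeKernel p n t h) := by
  induction n generalizing t with
  | zero =>
    refine lintegral_congr fun τ => ?_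
    congr 1
    funext i
    exact i.elim0
  | succ n ih =>
    have hg : Measurable fun a : (𝒵 × 𝒵) × Tree (𝒵 × 𝒵) n × Tree (𝒵 × 𝒵) n => φ (graft a) :=
      hφ.comp measurable_graft
    rw [lintegral_pairTreeKernel_succ _ _ _ _ (φ := fun τ => φ (mirror τ))
      (hφ.comp measurable_mirror),
      lintegral_pairTreeKernel_succ _ _ _ _ hφ]
    have hm : Measurable fun a : 𝒵 × 𝒵 => ∫⁻ l, ∫⁻ r, φ (graft (a, l, r))
        ∂(pairTreeKernel p n (t + 1) (Fin.snoc h a.2))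
        ∂(pairTreeKernel p n (t + 1) (Fin.snoc h a.1)) := by
      have h1 : Measurable fun b : (𝒵 × 𝒵) × Tree (𝒵 × 𝒵) n => ∫⁻ r, φ (graft (b.1, b.2, r))
        ∂(pairTreeKernel p n (t + 1) (Fin.snoc h b.1.2)) := by
        have : Measurable fun c : ((𝒵 × 𝒵) × Tree (𝒵 × 𝒵) n) × Tree (𝒵 × 𝒵) n =>
            φ (graft (c.1.1, c.1.2, c.2)) := hg.comp (by fun_prop)
        exact this.lintegral_kernel_prod_right' (κ := (pairTreeKernel p n (t + 1)).comap
          (fun b : (𝒵 × 𝒵) × Tree (𝒵 × 𝒵) n => (Fin.snoc h b.1.2 : Fin (t + 1) → 𝒵))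
          (measurable_snoc measurable_const (by fun_prop)))
      exact h1.lintegral_kernel_prod_right' (κ := (pairTreeKernel p n (t + 1)).comap
          (fun b : 𝒵 × 𝒵 => (Fin.snoc h b.1 : Fin (t + 1) → 𝒵))
          (measurable_snoc measurable_const (by fun_prop)))
    conv_rhs => rw [lintegral_lintegral_swap hm.aemeasurable]
    refine lintegral_congr fun x => lintegral_congr fun y => ?_
    simp_rw [mirror_graft, Prod.swap_prod_mk]
    have e1 (l : Tree (𝒵 × 𝒵) n) := ih (t + 1) (Fin.snoc h y)
      (φ := fun r => φ (graft ((y, x), r, mirror l)))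
      (hg.comp (by fun_prop))
    simp_rw [e1]
    have h2 : Measurable fun l => ∫⁻ τ, φ (graft ((y, x), τ, l))
        ∂(pairTreeKernel p n (t + 1) (Fin.snoc h y)) :=
      Measurable.lintegral_prod_right' (f := fun a => φ (graft ((y, x), a.2, a.1)))
        (hg.comp (by fun_prop))
    rw [ih (t + 1) (Fin.snoc h x) h2, lintegral_lintegral_swap]
    exact (hg.comp (by fun_prop)).aemeasurable

lemma map_mirror_pairTreeKernel (p : (t : ℕ) → Kernel (Fin t → 𝒵) 𝒵)
    [∀ t, IsMarkovKernel (p t)] (n t : ℕ) (h : Fin t → 𝒵) :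
    (pairTreeKernel p n t h).map mirror = pairTreeKernel p n t h := by
  refine Measure.ext_of_lintegral _ fun φ hφ => ?_
  rw [lintegral_map hφ measurable_mirror, lintegral_mirror_pairTreeKernel _ _ _ _ hφ]

end Tangent

/-! ### Exponential moments on a fixed tree, and covering numbers -/

section Cover

/-- The sign `±1` encoded by a Boolean. -/
def sgn (b : Bool) : ℝ := if b = true then 1 else -1

lemma sgn_not (b : Bool) : sgn (!b) = -sgn b := by
  cases b <;> simp [sgn]

lemma abs_sgn (b : Bool) : |sgn b| = 1 := by
  cases b <;> simp [sgn]

/-- The exponential moment of a bounded predictable transform of random signs. -/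
lemma sum_exp_sgn_le (n : ℕ) (v : Tree ℝ n) (w : Fin n → ℝ) (B c : ℝ)
    (hB : ∀ t s, |v t s| ≤ B) :
    ∑ σ : Fin n → Bool, Real.exp (c * ∑ t, sgn (σ t) * w t * v.along σ t) ≤
      2 ^ n * Real.exp (c ^ 2 * B ^ 2 / 2 * ∑ t, w t ^ 2) := by
  induction n with
  | zero => simp
  | succ n ih =>
    have hlast (τ : Fin n → Bool) (b : Bool) :
        v.along (Fin.snoc τ b : Fin (n + 1) → Bool) (Fin.last n) = v (Fin.last n) τ := by
      unfold Tree.along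
      congr 1
      funext i
      exact Fin.snoc_castSucc (α := fun _ => Bool) b τ i
    have hinit (τ : Fin n → Bool) (b : Bool) (t : Fin n) :
        v.along (Fin.snoc τ b : Fin (n + 1) → Bool) t.castSucc =
          Tree.along (fun t => v t.castSucc : Tree ℝ n) τ t := by
      unfold Tree.along
      congr 1
      funext i
      exact Fin.snoc_castSucc (α := fun _ => Bool) b τ ⟨i, i.2.trans t.2⟩
    -- Given the earlier signs, the last tree value is fixed; the two last signs give `2 cosh y ≤ 2
    -- exp (y ^ 2 / 2)`.
    have hstep (τ : Fin n → Bool) :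
        Real.exp (c * ∑ t, sgn ((Fin.snoc τ true : Fin (n + 1) → Bool) t) * w t *
            v.along (Fin.snoc τ true : Fin (n + 1) → Bool) t) +
          Real.exp (c * ∑ t, sgn ((Fin.snoc τ false : Fin (n + 1) → Bool) t) * w t *
            v.along (Fin.snoc τ false : Fin (n + 1) → Bool) t) ≤
        Real.exp (c * ∑ t : Fin n, sgn (τ t) * w t.castSucc *
            Tree.along (fun t => v t.castSucc : Tree ℝ n) τ t) *
          (2 * Real.exp (c ^ 2 * B ^ 2 / 2 * w (Fin.last n) ^ 2)) := by
      simp only [Fin.sum_univ_castSucc, hlast, hinit, Fin.snoc_castSucc, Fin.snoc_last, mul_add,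
        Real.exp_add]
      rw [← mul_add]
      refine mul_le_mul_of_nonneg_left ?_ (Real.exp_pos _).le
      set y := c * (w (Fin.last n) * v (Fin.last n) τ) with hy
      have e : Real.exp (c * (sgn true * w (Fin.last n) * v (Fin.last n) τ)) +
          Real.exp (c * (sgn false * w (Fin.last n) * v (Fin.last n) τ)) = 2 * Real.cosh y := by
        rw [Real.cosh_eq, hy]
        simp [sgn]
        ring
      rw [e]
      refine mul_le_mul_of_nonneg_left ((Real.cosh_le_exp_half_sq y).trans ?_) zero_le_two
      rw [Real.exp_le_exp]
      have hv : v (Fin.last n) τ ^ 2 ≤ B ^ 2 := by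
        rw [← sq_abs]
        exact pow_le_pow_left₀ (abs_nonneg _) (hB _ _) 2
      have := mul_le_mul_of_nonneg_left hv (sq_nonneg (c * w (Fin.last n)))
      rw [hy]
      nlinarith
    rw [sum_bool_snoc]
    refine (Finset.sum_le_sum fun τ _ => hstep τ).trans ?_
    rw [← Finset.sum_mul]
    refine (mul_le_mul_of_nonneg_right (ih (fun t => v t.castSucc) (fun t => w t.castSucc)
      fun t s => hB _ _) (by positivity)).trans (le_of_eq ?_)
    rw [Fin.sum_univ_castSucc, mul_add, Real.exp_add]
    ring

variable {𝒵 : Type*}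

lemma abs_sum_mul_le {ι : Type*} [Fintype ι] (a x : ι → ℝ) {B : ℝ} (hx : ∀ i, |x i| ≤ B) :
    |∑ i, a i * x i| ≤ ∑ i, |a i| * B := by
  refine (Finset.abs_sum_le_sum_abs _ _).trans (Finset.sum_le_sum fun i _ => ?_)
  rw [abs_mul]
  exact mul_le_mul_of_nonneg_left (hx i) (abs_nonneg _)

lemma bddAbove_sum {ℱ : Set (𝒵 → ℝ)} {B : ℝ} (hB : ∀ f ∈ ℱ, ∀ z, |f z| ≤ B) {ι : Type*}
    [Fintype ι] (a : ι → ℝ) (z : ι → 𝒵) :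
    BddAbove (Set.range fun f : ℱ => ∑ i, a i * f.1 (z i)) := by
  refine ⟨∑ i, |a i| * B, ?_⟩
  rintro _ ⟨f, rfl⟩
  exact (le_abs_self _).trans (abs_sum_mul_le _ _ fun i => hB f.1 f.2 _)

lemma abs_clip_sub_le {B x y : ℝ} (hx : |x| ≤ B) : |max (-B) (min B y) - x| ≤ |y - x| := by
  obtain ⟨h1, h2⟩ := abs_le.1 hx
  rcases le_total B y with h | h
  · rw [min_eq_left h, max_eq_right (by linarith), abs_of_nonneg (by linarith),
      abs_of_nonneg (by linarith)]
    linarith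
  · rw [min_eq_right h]
    rcases le_total (-B) y with h' | h'
    · rw [max_eq_right h']
    · rw [max_eq_left h', abs_of_nonpos (by linarith), abs_of_nonpos (by linarith)]
      linarith

lemma abs_clip_le {B y : ℝ} (hB : 0 ≤ B) : |max (-B) (min B y)| ≤ B :=
  abs_le.2 ⟨le_max_left _ _, max_le (by linarith) (min_le_left _ _)⟩

/-- The infimum is attained because `ℕ∞` is well-ordered and covers exist: for `α ≥ 0` the set of
all trees is one. -/
lemma exists_isSeqCover_encard_eq {n : ℕ} (w : Fin n → ℝ) {α : ℝ} (hα : 0 ≤ α) (𝒢 : Set (𝒵 → ℝ))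
    (z : Tree 𝒵 n) :
    ∃ V : Set (Tree ℝ n), IsSeqCover w α 𝒢 z V ∧ V.encard = seqCoveringNumber w α 𝒢 z := by
  have hne : {V : Set (Tree ℝ n) | IsSeqCover w α 𝒢 z V}.Nonempty := by
    refine ⟨Set.univ, fun g _ σ => ⟨fun t s => g (z t s), Set.mem_univ _, ?_⟩⟩
    simpa [Tree.along] using hα
  have := csInf_mem (hne.image Set.encard)
  obtain ⟨V, hV, hVe⟩ := this
  refine ⟨V, hV, ?_⟩
  rw [hVe, sInf_image]
  rfl

/-- The exponential moment of the sequential Rademacher process over a class, in terms of its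
sequential covering number. -/
lemma sum_exp_iSup_le_seqCoveringNumber {ℱ : Set (𝒵 → ℝ)} (hne : ℱ.Nonempty) {B : ℝ}
    (hB0 : 0 ≤ B) (hB : ∀ f ∈ ℱ, ∀ z, |f z| ≤ B) {n : ℕ} (w : Fin n → ℝ) {c α : ℝ} (hc : 0 < c)
    (hα : 0 ≤ α) (z : Tree 𝒵 n) :
    ∑ σ : Fin n → Bool, ENNReal.ofReal
        (Real.exp (c * ⨆ f : ℱ, ∑ t, (sgn (σ t) * w t) * f.1 (z.along σ t))) ≤
      ENNReal.ofReal (2 ^ n * Real.exp (c * α + c ^ 2 * B ^ 2 / 2 * ∑ t, w t ^ 2)) *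
        (seqCoveringNumber w α ℱ z : ENNReal) := by
  obtain ⟨V, hV, hVe⟩ := exists_isSeqCover_encard_eq w hα ℱ z
  rw [← hVe]
  set C := 2 ^ n * Real.exp (c * α + c ^ 2 * B ^ 2 / 2 * ∑ t, w t ^ 2) with hC
  have hCpos : 0 < C := by positivity
  have : Nonempty ℱ := hne.to_subtype
  rcases V.finite_or_infinite with hfin | hinf
  · obtain ⟨V, rfl⟩ := hfin.exists_finset_coe
    -- Cover elements may be unbounded; truncation to `[-B, B]` brings them no farther from values
    -- of the class.
    let clip : Tree ℝ n → Tree ℝ n := fun v t s => max (-B) (min B (v t s))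
    have hσ (σ : Fin n → Bool) :
        Real.exp (c * ⨆ f : ℱ, ∑ t, (sgn (σ t) * w t) * f.1 (z.along σ t)) ≤
          ∑ v ∈ V, Real.exp (c * α) *
            Real.exp (c * ∑ t, sgn (σ t) * w t * (clip v).along σ t) := by
      set R := ∑ v ∈ V, Real.exp (c * α) *
            Real.exp (c * ∑ t, sgn (σ t) * w t * (clip v).along σ t) with hR
      have hf (f : ℱ) : Real.exp (c * ∑ t, (sgn (σ t) * w t) * f.1 (z.along σ t)) ≤ R := by
        obtain ⟨v, hvV, hv⟩ := hV f.1 f.2 σ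
        -- The cover element depends on both `f` and `σ`, so it is absorbed into the sum over all of
        -- `V`.
        refine le_trans ?_ (Finset.single_le_sum (f := fun v => Real.exp (c * α) *
            Real.exp (c * ∑ t, sgn (σ t) * w t * (clip v).along σ t))
            (fun v _ => by positivity) (Finset.mem_coe.1 hvV))
        rw [← Real.exp_add, Real.exp_le_exp, ← mul_add]
        refine mul_le_mul_of_nonneg_left ?_ hc.le
        have h1 : ∑ t, (sgn (σ t) * w t) * f.1 (z.along σ t) -
            ∑ t, sgn (σ t) * w t * (clip v).along σ t ≤
            ∑ t, ‖w‖ * |v.along σ t - f.1 (z.along σ t)| := by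
          rw [← Finset.sum_sub_distrib]
          refine Finset.sum_le_sum fun t _ => ?_
          rw [← mul_sub]
          refine (le_abs_self _).trans ?_
          rw [abs_mul, abs_mul, abs_sgn, one_mul]
          refine mul_le_mul (norm_le_pi_norm w t) ?_ (abs_nonneg _) (norm_nonneg _)
          rw [abs_sub_comm]
          exact abs_clip_sub_le (hB _ f.2 _)
        rw [← Finset.mul_sum] at h1
        linarith
      have hRpos : 0 < R := (Real.exp_pos _).trans_le (hf (Classical.arbitrary ℱ))
      -- Taking logarithms isolates the supremum, which is then bounded member by member.
      rw [← Real.le_log_iff_exp_le hRpos, mul_comm, ← le_div_iff₀ hc]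
      refine ciSup_le fun f => ?_
      rw [le_div_iff₀ hc, mul_comm, Real.le_log_iff_exp_le hRpos]
      exact hf f
    rw [← ENNReal.ofReal_sum_of_nonneg fun _ _ => (Real.exp_pos _).le,
      Set.encard_coe_eq_coe_finsetCard]
    have e : ENNReal.ofReal C * (((V.card : ℕ∞) : ENNReal)) = ENNReal.ofReal (V.card * C) := by
      rw [ENNReal.ofReal_mul (Nat.cast_nonneg _), ENNReal.ofReal_natCast, mul_comm]
      rfl
    rw [e]
    refine ENNReal.ofReal_le_ofReal ?_
    refine (Finset.sum_le_sum fun σ _ => hσ σ).trans ?_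
    rw [Finset.sum_comm, ← nsmul_eq_mul, ← Finset.sum_const]
    refine Finset.sum_le_sum fun v _ => ?_
    rw [← Finset.mul_sum]
    refine (mul_le_mul_of_nonneg_left (sum_exp_sgn_le n (clip v) w B c
      fun t s => abs_clip_le hB0) (Real.exp_pos _).le).trans (le_of_eq ?_)
    rw [hC, Real.exp_add]
    ring
  · rw [hinf.encard_eq]
    simp [ENNReal.mul_top, hCpos]

lemma IsSeqCover.mono_weight {n : ℕ} {w u : Fin n → ℝ} {α β : ℝ} {k : ℝ} (hk : 0 ≤ k)
    (hw : ‖w‖ ≤ k * ‖u‖) (hβ : k * α ≤ β) {𝒢 : Set (𝒵 → ℝ)} {z : Tree 𝒵 n} {V : Set (Tree ℝ n)}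
    (hV : IsSeqCover u α 𝒢 z V) : IsSeqCover w β 𝒢 z V := by
  intro g hg σ
  obtain ⟨v, hv, h⟩ := hV g hg σ
  refine ⟨v, hv, le_trans ?_ hβ⟩
  refine (mul_le_mul_of_nonneg_right hw (Finset.sum_nonneg fun _ _ => abs_nonneg _)).trans ?_
  rw [mul_assoc]
  exact mul_le_mul_of_nonneg_left h hk

lemma seqCoveringNumber_mono_weight {n : ℕ} {w u : Fin n → ℝ} {α β : ℝ} {k : ℝ} (hk : 0 ≤ k)
    (hw : ‖w‖ ≤ k * ‖u‖) (hβ : k * α ≤ β) (𝒢 : Set (𝒵 → ℝ)) (z : Tree 𝒵 n) :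
    seqCoveringNumber w β 𝒢 z ≤ seqCoveringNumber u α 𝒢 z :=
  le_iInf₂ fun V hV => iInf₂_le V (IsSeqCover.mono_weight hk hw hβ hV)

lemma seqCoveringNumber_neg {n : ℕ} (w : Fin n → ℝ) (α : ℝ) (𝒢 : Set (𝒵 → ℝ)) (z : Tree 𝒵 n) :
    seqCoveringNumber (-w) α 𝒢 z = seqCoveringNumber w α 𝒢 z := by
  simp only [seqCoveringNumber, IsSeqCover, norm_neg]

lemma one_le_seqCoveringNumber {n : ℕ} (w : Fin n → ℝ) (α : ℝ) {𝒢 : Set (𝒵 → ℝ)}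
    (hne : 𝒢.Nonempty) (z : Tree 𝒵 n) : 1 ≤ seqCoveringNumber w α 𝒢 z := by
  refine le_iInf₂ fun V hV => ?_
  obtain ⟨g, hg⟩ := hne
  obtain ⟨v, hv, -⟩ := hV g hg fun _ => true
  exact Set.one_le_encard_iff_nonempty.2 ⟨v, hv⟩

lemma seqCoveringNumber_sub_const_le {n : ℕ} (w : Fin n → ℝ) (α : ℝ) (𝒢 : Set (𝒵 → ℝ)) (c : ℝ)
    (z : Tree 𝒵 n) :
    seqCoveringNumber w α ((fun f x => f x - c) '' 𝒢) z ≤ seqCoveringNumber w α 𝒢 z := by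
  refine le_iInf₂ fun V hV => ?_
  refine (iInf₂_le ((fun (v : Tree ℝ n) t s => v t s - c) '' V) ?_).trans (Set.encard_image_le _ _)
  rintro _ ⟨g, hg, rfl⟩ σ
  obtain ⟨v, hv, h⟩ := hV g hg σ
  refine ⟨_, ⟨v, hv, rfl⟩, ?_⟩
  simpa [Tree.along] using h

end Cover

/-! ### The exponential deviation inequality -/

section Concentration

variable {Ω 𝒵 : Type*} [MeasurableSpace Ω] [MeasurableSpace 𝒵]

lemma IsMeasurableClass.aemeasurable_iSup {ℱ : Set (𝒵 → ℝ)} (hℱ : IsMeasurableClass ℱ)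
    {β : Type*} [MeasurableSpace β] (ν : Measure β) [IsProbabilityMeasure ν] {n : ℕ}
    (a : Fin n → ℝ) {g : β → Fin n → 𝒵} (hg : Measurable g) :
    AEMeasurable (fun b => ⨆ f : ℱ, ∑ i, a i * f.1 (g b i)) ν := by
  have := Measure.isProbabilityMeasure_map (μ := ν) hg.aemeasurable
  exact (hℱ.2 n a (ν.map g)).comp_measurable hg

/-- A weighted sum of differences is a weighted sum over `n + n` points, with weights `a` and `-a`.
-/
lemma IsMeasurableClass.aemeasurable_iSup_sub {ℱ : Set (𝒵 → ℝ)} (hℱ : IsMeasurableClass ℱ)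
    {n : ℕ} (a : Fin n → ℝ) (ν : Measure (Fin n → 𝒵 × 𝒵)) [IsProbabilityMeasure ν] :
    AEMeasurable (fun u => ⨆ f : ℱ, ∑ i, a i * (f.1 (u i).2 - f.1 (u i).1)) ν := by
  have hg : Measurable fun u : Fin n → 𝒵 × 𝒵 =>
      (Fin.append (fun i => (u i).2) (fun i => (u i).1) : Fin (n + n) → 𝒵) := by
    refine measurable_pi_lambda _ fun i => ?_
    refine Fin.addCases (fun j => ?_) (fun j => ?_) i
    · simp only [Fin.append_left]
      fun_prop
    · simp only [Fin.append_right]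
      fun_prop
  have := hℱ.aemeasurable_iSup ν (Fin.append a fun i => -a i) hg
  simpa only [Fin.sum_univ_add, Fin.append_left, Fin.append_right, neg_mul, mul_sub,
    Finset.sum_neg_distrib, Finset.sum_sub_distrib, ← sub_eq_add_neg] using this

/-- Subadditivity of the supremum followed by AM-GM decouples the two samples, at the price of
doubling `c`. -/
lemma two_mul_exp_iSup_le {𝒵 : Type*} {ℱ : Set (𝒵 → ℝ)} (hne : ℱ.Nonempty) {B : ℝ}
    (hB : ∀ f ∈ ℱ, ∀ z, |f z| ≤ B) {n : ℕ} (a : Fin n → ℝ) (x y : Fin n → 𝒵) {c : ℝ}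
    (hc : 0 ≤ c) :
    2 * Real.exp (c * ⨆ f : ℱ, ∑ i, a i * (f.1 (x i) - f.1 (y i))) ≤
      Real.exp (2 * c * ⨆ f : ℱ, ∑ i, a i * f.1 (x i)) +
        Real.exp (2 * c * ⨆ f : ℱ, ∑ i, (-a i) * f.1 (y i)) := by
  have : Nonempty ℱ := hne.to_subtype
  have h1 : ⨆ f : ℱ, ∑ i, a i * (f.1 (x i) - f.1 (y i)) ≤
      (⨆ f : ℱ, ∑ i, a i * f.1 (x i)) + ⨆ f : ℱ, ∑ i, (-a i) * f.1 (y i) := by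
    refine ciSup_le fun f => ?_
    refine le_trans (le_of_eq ?_) (add_le_add (le_ciSup (bddAbove_sum hB a x) f)
      (le_ciSup (bddAbove_sum hB (fun i => -a i) y) f))
    simp only [mul_sub, neg_mul, Finset.sum_sub_distrib, Finset.sum_neg_distrib, ← sub_eq_add_neg]
  have h2 := Real.exp_le_exp.2 (mul_le_mul_of_nonneg_left h1 hc)
  rw [mul_add, Real.exp_add] at h2
  set P := ⨆ f : ℱ, ∑ i, a i * f.1 (x i)
  set Q := ⨆ f : ℱ, ∑ i, (-a i) * f.1 (y i)
  have e1 : Real.exp (2 * c * P) = Real.exp (c * P) ^ 2 := by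
    rw [← Real.exp_nat_mul]; congr 1; push_cast; ring
  have e2 : Real.exp (2 * c * Q) = Real.exp (c * Q) ^ 2 := by
    rw [← Real.exp_nat_mul]; congr 1; push_cast; ring
  rw [e1, e2]
  nlinarith [sq_nonneg (Real.exp (c * P) - Real.exp (c * Q))]

lemma measurable_fst_tree {n : ℕ} :
    Measurable fun (τ : Tree (𝒵 × 𝒵) n) => (fun t s => (τ t s).1 : Tree 𝒵 n) :=
  measurable_pi_lambda _ fun t => measurable_pi_lambda _ fun s => by fun_prop

instance isProbabilityMeasure_treeLaw (p : (t : ℕ) → Kernel (Fin t → 𝒵) 𝒵)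
    [∀ t, IsMarkovKernel (p t)] (n : ℕ) : IsProbabilityMeasure (treeLaw p n) :=
  Measure.isProbabilityMeasure_map measurable_fst_tree.aemeasurable

/-- Symmetrization and covering: the exponential moment of the decoupled process on the random
tree is controlled by the expected sequential covering number. -/
lemma sum_lintegral_swapPath_le {p : (t : ℕ) → Kernel (Fin t → 𝒵) 𝒵} [∀ t, IsMarkovKernel (p t)]
    {ℱ : Set (𝒵 → ℝ)} (hℱ : IsMeasurableClass ℱ) (hne : ℱ.Nonempty) {B : ℝ} (hB0 : 0 ≤ B)
    (hB : ∀ f ∈ ℱ, ∀ z, |f z| ≤ B) {T : ℕ} (w : Fin T → ℝ) {c α : ℝ} (hc : 0 < c) (hα : 0 ≤ α) :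
    ∑ σ : Fin T → Bool, ∫⁻ τ, ENNReal.ofReal (Real.exp (c * ⨆ f : ℱ,
        ∑ t, w t * (f.1 (swapPath τ σ t).2 - f.1 (swapPath τ σ t).1)))
        ∂(pairTreeKernel p T 0 fun i => i.elim0) ≤
      ENNReal.ofReal (2 ^ T * Real.exp (2 * c * α + (2 * c) ^ 2 * B ^ 2 / 2 * ∑ t, w t ^ 2)) *
        expectedCoveringNumber p w α ℱ := by
  set P := pairTreeKernel p T 0 fun i => i.elim0
  let ψ : (Fin T → Bool) → Tree 𝒵 T → ENNReal := fun σ z => ENNReal.ofReal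
    (Real.exp (2 * c * ⨆ f : ℱ, ∑ t, (sgn (σ t) * (-w) t) * f.1 (z.along σ t)))
  have halong (σ : Fin T → Bool) : Measurable fun z : Tree 𝒵 T => z.along σ := by
    refine measurable_pi_lambda _ fun t => ?_
    unfold Tree.along
    fun_prop
  have hψm (σ) : AEMeasurable (ψ σ) (treeLaw p T) :=
    ((hℱ.aemeasurable_iSup (treeLaw p T) (fun t => sgn (σ t) * (-w) t)
      (halong σ)).const_mul _).exp.ennreal_ofReal
  let fst : Tree (𝒵 × 𝒵) T → Tree 𝒵 T := fun τ t s => (τ t s).1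
  have hfst : Measurable fst := measurable_fst_tree
  have hψm' (σ) : AEMeasurable (fun τ => ψ σ (fst τ)) P :=
    (hψm σ).comp_measurable hfst
  -- As `ψ` is only a.e. measurable, invariance is used at the level of measures.
  have hmir (σ : Fin T → Bool) :
      ∫⁻ τ, ψ (fun t => !(σ t)) (fst (mirror τ)) ∂P = ∫⁻ τ, ψ (fun t => !(σ t)) (fst τ) ∂P := by
    have h := map_mirror_pairTreeKernel p T 0 fun i => i.elim0
    have h2 := lintegral_map' (μ := P) (f := fun τ => ψ (fun t => !(σ t)) (fst τ))
      (g := mirror) (by rw [h]; exact hψm' _) measurable_mirror.aemeasurable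
    rw [h] at h2
    exact h2.symm
  have hpt (σ : Fin T → Bool) (τ : Tree (𝒵 × 𝒵) T) :
      2 * ENNReal.ofReal (Real.exp (c * ⨆ f : ℱ,
        ∑ t, w t * (f.1 (swapPath τ σ t).2 - f.1 (swapPath τ σ t).1))) ≤
      ψ σ (fst τ) + ψ (fun t => !(σ t)) (fst (mirror τ)) := by
    have e1 (f : ℱ) : ∑ t, w t * (f.1 (swapPath τ σ t).2 - f.1 (swapPath τ σ t).1) =
        ∑ t, (sgn (σ t) * w t) * (f.1 (τ.along σ t).2 - f.1 (τ.along σ t).1) := by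
      refine Finset.sum_congr rfl fun t _ => ?_
      unfold swapPath sgn
      split_ifs
      · ring
      · simp only [Prod.fst_swap, Prod.snd_swap]
        ring
    simp_rw [e1]
    have h := two_mul_exp_iSup_le hne hB (fun t => sgn (σ t) * w t)
      (fun t => (τ.along σ t).2) (fun t => (τ.along σ t).1) hc.le
    -- Second samples along `σ` are first samples of the mirrored tree along the opposite path; the
    -- sign flip is absorbed by `-w`.
    have e2 (f : ℱ) : ∑ t, (sgn (σ t) * w t) * f.1 (τ.along σ t).2 =
        ∑ t, (sgn (!(σ t)) * (-w) t) * f.1 ((fst (mirror τ)).along (fun t => !(σ t)) t) := by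
      refine Finset.sum_congr rfl fun t _ => ?_
      simp [sgn_not, fst, mirror, Tree.along]
    have e3 (f : ℱ) : ∑ t, (-(sgn (σ t) * w t)) * f.1 (τ.along σ t).1 =
        ∑ t, (sgn (σ t) * (-w) t) * f.1 ((fst τ).along σ t) := by
      refine Finset.sum_congr rfl fun t _ => ?_
      simp [fst, Tree.along]
    simp_rw [e2, e3] at h
    have h' := ENNReal.ofReal_le_ofReal h
    rw [ENNReal.ofReal_mul zero_le_two, ENNReal.ofReal_add (Real.exp_pos _).le (Real.exp_pos _).le,
      ENNReal.ofReal_ofNat] at h'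
    rw [add_comm]
    exact h'
  have hsum : 2 * ∑ σ : Fin T → Bool, ∫⁻ τ, ENNReal.ofReal (Real.exp (c * ⨆ f : ℱ,
        ∑ t, w t * (f.1 (swapPath τ σ t).2 - f.1 (swapPath τ σ t).1))) ∂P ≤
      2 * ∑ σ, ∫⁻ τ, ψ σ (fst τ) ∂P := by
    have hnot : ∑ σ : Fin T → Bool, ∫⁻ τ, ψ (fun t => !(σ t)) (fst τ) ∂P =
        ∑ σ, ∫⁻ τ, ψ σ (fst τ) ∂P :=
      (Equiv.arrowCongr (Equiv.refl (Fin T)) Equiv.boolNot).sum_comp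
        fun σ => ∫⁻ τ, ψ σ (fst τ) ∂P
    rw [Finset.mul_sum, two_mul (∑ σ, _)]
    nth_rw 2 [← hnot]
    rw [← Finset.sum_add_distrib]
    refine Finset.sum_le_sum fun σ _ => ?_
    rw [← hmir, ← lintegral_add_left' (hψm' σ), ← lintegral_const_mul' _ _ (by simp)]
    exact lintegral_mono fun τ => hpt σ τ
  have hsum' := (ENNReal.mul_le_mul_iff_right (by simp) (by simp)).1 hsum
  refine hsum'.trans ?_
  have e (σ : Fin T → Bool) : ∫⁻ τ, ψ σ (fst τ) ∂P = ∫⁻ z, ψ σ z ∂(treeLaw p T) :=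
    (lintegral_map' (hψm σ) hfst.aemeasurable).symm
  simp_rw [e]
  rw [← lintegral_finsetSum' _ fun σ _ => hψm σ, expectedCoveringNumber,
    ← lintegral_const_mul' _ _ ENNReal.ofReal_ne_top]
  refine lintegral_mono fun z => ?_
  have := sum_exp_iSup_le_seqCoveringNumber hne hB0 hB (-w) (c := 2 * c) (by positivity) hα z
  rw [seqCoveringNumber_neg] at this
  simpa only [Pi.neg_apply, neg_sq, ψ] using this

/-- Jensen's inequality for `exp` under the tangent law, conditionally on the observed past. -/
lemma exp_sum_condMean_sub_le {Ω : Type*} (p : (t : ℕ) → Kernel (Fin t → 𝒵) 𝒵)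
    [∀ t, IsMarkovKernel (p t)] (Z : ℕ → Ω → 𝒵) {f : 𝒵 → ℝ} (hf : Measurable f) {B : ℝ}
    (hB : ∀ z, |f z| ≤ B) {T : ℕ} (w : Fin T → ℝ) (c : ℝ) (ω : Ω) :
    ENNReal.ofReal (Real.exp (c * ∑ t, w t * (condMean p Z f t ω - f (Z t ω)))) ≤
      ∫⁻ x, ENNReal.ofReal (Real.exp (c * ∑ t, w t * (f (x t) - f (Z t ω))))
        ∂(tangentKernel p T (past Z T ω)) := by
  set D := tangentKernel p T (past Z T ω)
  have hfi (t : Fin T) : Integrable (fun x : Fin T → 𝒵 => f (x t)) D :=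
    Integrable.of_bound (hf.comp (measurable_pi_apply t)).aestronglyMeasurable B
      (.of_forall fun _ => hB _)
  have hint (t : Fin T) : ∫ x, f (x t) ∂D = condMean p Z f t ω := by
    unfold condMean
    rw [← map_eval_tangentKernel p Z ω T t,
      integral_map (measurable_pi_apply t).aemeasurable hf.aestronglyMeasurable]
  have hgm : Measurable fun x : Fin T → 𝒵 => c * ∑ t, w t * (f (x t) - f (Z t ω)) := by
    have (t : Fin T) : Measurable fun x : Fin T → 𝒵 => f (x t) := hf.comp (measurable_pi_apply t)
    fun_prop
  have hgi : Integrable (fun x : Fin T → 𝒵 => c * ∑ t, w t * (f (x t) - f (Z t ω))) D :=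
    (integrable_finsetSum _ fun t _ =>
      (((hfi t).sub (integrable_const _)).const_mul _)).const_mul _
  have hgint : ∫ x, c * ∑ t, w t * (f (x t) - f (Z t ω)) ∂D =
      c * ∑ t, w t * (condMean p Z f t ω - f (Z t ω)) := by
    rw [integral_const_mul, integral_finsetSum Finset.univ
      (f := fun (t : Fin T) (x : Fin T → 𝒵) => w t * (f (x t) - f (Z t ω)))
      fun t _ => (((hfi t).sub (integrable_const _)).const_mul _)]
    congr 1
    refine Finset.sum_congr rfl fun t _ => ?_
    rw [integral_const_mul, integral_sub (hfi t) (integrable_const _), hint]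
    simp
  have hei : Integrable
      (fun x : Fin T → 𝒵 => Real.exp (c * ∑ t, w t * (f (x t) - f (Z t ω)))) D := by
    refine Integrable.of_bound hgm.exp.aestronglyMeasurable
      (Real.exp (|c| * ∑ t, |w t| * (B + B))) (.of_forall fun x => ?_)
    rw [Real.norm_eq_abs, Real.abs_exp, Real.exp_le_exp]
    refine (le_abs_self _).trans ?_
    rw [abs_mul]
    refine mul_le_mul_of_nonneg_left (abs_sum_mul_le _ _ fun t => ?_) (abs_nonneg _)
    exact (abs_sub _ _).trans (add_le_add (hB _) (hB _))
  rw [← hgint, ← ofReal_integral_eq_lintegral_ofReal hei (.of_forall fun _ => (Real.exp_pos _).le)]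
  exact ENNReal.ofReal_le_ofReal (convexOn_exp.map_integral_le Real.continuous_exp.continuousOn
    isClosed_univ (.of_forall fun _ => Set.mem_univ _) hgi hei)

/-- Exponential deviation bound for a weighted martingale process over a bounded class. -/
theorem measure_exists_deviation_mul_exp_le (μ : Measure Ω) [IsProbabilityMeasure μ] {T : ℕ}
    {Z : ℕ → Ω → 𝒵} (hZ : ∀ t ≤ T, Measurable (Z t)) {p : (t : ℕ) → Kernel (Fin t → 𝒵) 𝒵}
    [∀ t, IsMarkovKernel (p t)] (hp : IsDistributedAccordingTo μ Z p T)
    {ℱ : Set (𝒵 → ℝ)} (hℱ : IsMeasurableClass ℱ) {B : ℝ} (hB0 : 0 ≤ B)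
    (hB : ∀ f ∈ ℱ, ∀ z, |f z| ≤ B) (w : Fin T → ℝ) {c α : ℝ} (hc : 0 < c) (hα : 0 ≤ α) (ε : ℝ) :
    ENNReal.ofReal (Real.exp (c * ε)) *
        μ {ω | ∃ f ∈ ℱ, ε ≤ ∑ t, w t * (condMean p Z f t ω - f (Z t ω))} ≤
      ENNReal.ofReal (Real.exp (2 * c * α + (2 * c) ^ 2 * B ^ 2 / 2 * ∑ t, w t ^ 2)) *
        expectedCoveringNumber p w α ℱ := by
  rcases ℱ.eq_empty_or_nonempty with rfl | hne
  · simp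
  have : Nonempty ℱ := hne.to_subtype
  have hpast := measurable_past hZ le_rfl
  let φ : (Fin T → 𝒵 × 𝒵) → ENNReal := fun u => ENNReal.ofReal
    (Real.exp (c * ⨆ f : ℱ, ∑ t, w t * (f.1 (u t).2 - f.1 (u t).1)))
  have hφ (ν : Measure (Fin T → 𝒵 × 𝒵)) [IsProbabilityMeasure ν] : AEMeasurable φ ν :=
    ((hℱ.aemeasurable_iSup_sub w ν).const_mul _).exp.ennreal_ofReal
  have := Measure.isProbabilityMeasure_map (μ := μ) hpast.aemeasurable
  let ν := ((μ.map (past Z T)) ⊗ₘ tangentKernel p T).map zipPair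
  have hν : IsProbabilityMeasure ν :=
    Measure.isProbabilityMeasure_map measurable_zipPair.aemeasurable
  set P := pairTreeKernel p T 0 fun i => i.elim0
  have hνint {g : (Fin T → 𝒵 × 𝒵) → ENNReal} (hg : Measurable g) : ∫⁻ u, g u ∂ν =
      ∫⁻ ω, ∫⁻ x, g (zipPair (past Z T ω, x)) ∂(tangentKernel p T (past Z T ω)) ∂μ := by
    have hgz := hg.comp (measurable_zipPair (𝒵 := 𝒵) (t := T))
    rw [lintegral_map hg measurable_zipPair]
    refine (Measure.lintegral_compProd hgz).trans ?_
    rw [lintegral_map hgz.lintegral_kernel_prod_right' hpast]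
    rfl
  -- The identity of integrals is upgraded to one of measures, so that it applies to the merely a.e.
  -- measurable `φ`.
  have hlaw : (2 ^ T : ENNReal) • ν = ∑ σ : Fin T → Bool, P.map fun τ => swapPath τ σ := by
    refine Measure.ext_of_lintegral _ fun g hg => ?_
    rw [lintegral_smul_measure, lintegral_finsetSum_measure, smul_eq_mul, hνint hg,
      lintegral_tangent_eq_lintegral_swapPath hZ hp hg,
      lintegral_finsetSum _ (f := fun (σ : Fin T → Bool) τ => g (swapPath τ σ))
        fun σ _ => hg.comp (measurable_swapPath σ)]
    exact Finset.sum_congr rfl fun σ _ => (lintegral_map hg (measurable_swapPath σ)).symm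
  have hφν : 2 ^ T * ∫⁻ u, φ u ∂ν = ∑ σ, ∫⁻ τ, φ (swapPath τ σ) ∂P := by
    rw [← smul_eq_mul, ← lintegral_smul_measure, hlaw, lintegral_finsetSum_measure]
    refine Finset.sum_congr rfl fun σ _ => ?_
    have := Measure.isProbabilityMeasure_map (μ := P) (measurable_swapPath σ).aemeasurable
    exact lintegral_map' (hφ _) (measurable_swapPath σ).aemeasurable
  have hbound := (hφν.trans_le (sum_lintegral_swapPath_le hℱ hne hB0 hB w hc hα))
  rw [ENNReal.ofReal_mul (by positivity), mul_assoc, ENNReal.ofReal_pow zero_le_two,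
    ENNReal.ofReal_ofNat] at hbound
  have hbound' := (ENNReal.mul_le_mul_iff_right (by simp) (by simp)).1 hbound
  refine le_trans ?_ hbound'
  -- Markov's inequality is applied to a measurable version, which agrees with `φ` under almost
  -- every conditional tangent law.
  let φ' := (hφ ν).mk φ
  have hφ'm : Measurable φ' := (hφ ν).measurable_mk
  rw [lintegral_congr_ae (hφ ν).ae_eq_mk, hνint hφ'm]
  have hgm : Measurable fun ω =>
      ∫⁻ x, φ' (zipPair (past Z T ω, x)) ∂(tangentKernel p T (past Z T ω)) :=
    (hφ'm.comp (measurable_zipPair (𝒵 := 𝒵) (t := T))).lintegral_kernel_prod_right'.comp hpast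
  refine le_trans ?_ (mul_meas_ge_le_lintegral₀ hgm.aemeasurable
    (ENNReal.ofReal (Real.exp (c * ε))))
  refine mul_le_mul' le_rfl ?_
  have hae : ∀ᵐ ω ∂μ, ∀ᵐ x ∂(tangentKernel p T (past Z T ω)),
      φ (zipPair (past Z T ω, x)) = φ' (zipPair (past Z T ω, x)) :=
    ae_of_ae_map hpast.aemeasurable (Measure.ae_ae_of_ae_compProd
      (ae_of_ae_map measurable_zipPair.aemeasurable (hφ ν).ae_eq_mk))
  refine measure_mono_ae ?_
  filter_upwards [hae] with ω hω
  rintro ⟨f, hf, hε⟩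
  change _ ≤ ∫⁻ x, φ' (zipPair (past Z T ω, x)) ∂(tangentKernel p T (past Z T ω))
  rw [← lintegral_congr_ae hω]
  refine le_trans (ENNReal.ofReal_le_ofReal (Real.exp_le_exp.2
    (mul_le_mul_of_nonneg_left hε hc.le))) ?_
  refine (exp_sum_condMean_sub_le p Z (hℱ.1 f hf) (hB f hf) w c ω).trans ?_
  refine lintegral_mono fun x => ENNReal.ofReal_le_ofReal (Real.exp_le_exp.2
    (mul_le_mul_of_nonneg_left ?_ hc.le))
  have hbdd : BddAbove (Set.range fun g : ℱ => ∑ t, w t *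
      (g.1 (zipPair (past Z T ω, x) t).2 - g.1 (zipPair (past Z T ω, x) t).1)) := by
    refine ⟨∑ t, |w t| * (B + B), ?_⟩
    rintro _ ⟨g, rfl⟩
    exact (le_abs_self _).trans (abs_sum_mul_le _ _ fun t =>
      (abs_sub _ _).trans (add_le_add (hB _ g.2 _) (hB _ g.2 _)))
  exact le_ciSup hbdd ⟨f, hf⟩

end Concentration

/-! ### From exponential moments to the forecasting bound -/

section Forecasting

variable {Ω 𝒵 : Type*} [MeasurableSpace Ω] [MeasurableSpace 𝒵]

lemma IsMeasurableClass.sub_const {ℱ : Set (𝒵 → ℝ)} (hℱ : IsMeasurableClass ℱ)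
    (hne : ℱ.Nonempty) {B : ℝ} (hB : ∀ f ∈ ℱ, ∀ z, |f z| ≤ B) (c : ℝ) :
    IsMeasurableClass ((fun f x => f x - c) '' ℱ) := by
  have : Nonempty ℱ := hne.to_subtype
  refine ⟨?_, fun n a ν _ => ?_⟩
  · rintro _ ⟨f, hf, rfl⟩
    exact (hℱ.1 f hf).sub_const c
  · have e (z : Fin n → 𝒵) :
        ⨆ g : ((fun (f : 𝒵 → ℝ) x => f x - c) '' ℱ), ∑ i, a i * g.1 (z i) =
          (⨆ f : ℱ, ∑ i, a i * f.1 (z i)) + -∑ i, a i * c := by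
      rw [ciSup_add (bddAbove_sum hB a z),
        ← (Set.imageFactorization_surjective (f := fun (f : 𝒵 → ℝ) x => f x - c)
          (s := ℱ)).iSup_comp]
      refine iSup_congr fun f => ?_
      simp [Set.imageFactorization, sub_eq_add_neg, mul_add, Finset.sum_add_distrib]
    simp_rw [e]
    exact (hℱ.2 n a ν).add_const _

lemma expectedCoveringNumber_sub_const_le (p : (t : ℕ) → Kernel (Fin t → 𝒵) 𝒵) {n : ℕ}
    (w : Fin n → ℝ) (α : ℝ) (𝒢 : Set (𝒵 → ℝ)) (c : ℝ) :
    expectedCoveringNumber p w α ((fun f x => f x - c) '' 𝒢) ≤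
      expectedCoveringNumber p w α 𝒢 :=
  lintegral_mono fun z => ENat.toENNReal_le.2 (seqCoveringNumber_sub_const_le w α 𝒢 c z)

lemma expectedCoveringNumber_mono_weight (p : (t : ℕ) → Kernel (Fin t → 𝒵) 𝒵) {n : ℕ}
    {w u : Fin n → ℝ} {α β : ℝ} {k : ℝ} (hk : 0 ≤ k) (hw : ‖w‖ ≤ k * ‖u‖) (hβ : k * α ≤ β)
    (𝒢 : Set (𝒵 → ℝ)) :
    expectedCoveringNumber p w β 𝒢 ≤ expectedCoveringNumber p u α 𝒢 :=
  lintegral_mono fun z => ENat.toENNReal_le.2 (seqCoveringNumber_mono_weight hk hw hβ 𝒢 z)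

lemma one_le_expectedCoveringNumber (p : (t : ℕ) → Kernel (Fin t → 𝒵) 𝒵)
    [∀ t, IsMarkovKernel (p t)] {n : ℕ} (w : Fin n → ℝ) (α : ℝ) {𝒢 : Set (𝒵 → ℝ)}
    (hne : 𝒢.Nonempty) : 1 ≤ expectedCoveringNumber p w α 𝒢 := by
  have h : ∫⁻ _, 1 ∂(treeLaw p n) ≤ expectedCoveringNumber p w α 𝒢 :=
    lintegral_mono fun z => by
      simpa using ENat.toENNReal_le.2 (one_le_seqCoveringNumber w α hne z)
  simpa using h

lemma condMean_sub_const (p : (t : ℕ) → Kernel (Fin t → 𝒵) 𝒵) [∀ t, IsMarkovKernel (p t)]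
    {Ω : Type*} (Z : ℕ → Ω → 𝒵) {f : 𝒵 → ℝ} (hf : Measurable f) {B : ℝ} (hB : ∀ z, |f z| ≤ B)
    (c : ℝ) (t : ℕ) (ω : Ω) :
    condMean p Z (fun x => f x - c) t ω = condMean p Z f t ω - c := by
  unfold condMean
  rw [integral_sub (Integrable.of_bound hf.aestronglyMeasurable B (.of_forall hB))
    (integrable_const c)]
  simp

lemma abs_condMean_le (p : (t : ℕ) → Kernel (Fin t → 𝒵) 𝒵) [∀ t, IsMarkovKernel (p t)]
    {Ω : Type*} (Z : ℕ → Ω → 𝒵) {f : 𝒵 → ℝ} {B : ℝ} (hB : ∀ z, |f z| ≤ B) (t : ℕ) (ω : Ω) :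
    |condMean p Z f t ω| ≤ B := by
  refine (norm_integral_le_of_norm_le_const (f := f) (C := B) (.of_forall hB)).trans ?_
  simp

lemma l2norm_eq_norm {T : ℕ} (w : Fin T → ℝ) : l2norm w = ‖WithLp.toLp 2 w‖ := by
  rw [EuclideanSpace.norm_eq, l2norm]
  simp

lemma l2norm_le_add {T : ℕ} (q w : Fin T → ℝ) : l2norm w ≤ l2norm q + l2norm (q - w) := by
  simp only [l2norm_eq_norm]
  refine le_trans (le_of_eq ?_) (norm_sub_le _ _)
  rw [← WithLp.toLp_sub, sub_sub_cancel]

lemma l2norm_lastUniform_pos {T s : ℕ} (hs : 1 ≤ s) (hsT : s ≤ T) :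
    0 < l2norm (lastUniform T s) := by
  rw [l2norm_eq_norm, norm_pos_iff]
  intro h
  have h1 := congrFun (congrArg WithLp.ofLp h) ⟨T - 1, by omega⟩
  simp only [lastUniform, WithLp.ofLp_zero, Pi.zero_apply] at h1
  rw [if_pos (by omega)] at h1
  have : (0 : ℝ) < s := by exact_mod_cast hs
  exact (one_div_pos.2 this).ne' h1

/-- High-probability deviation bound for a class with values in an interval of length `M`. -/
lemma measure_exists_deviation_le (μ : Measure Ω) [IsProbabilityMeasure μ] {T : ℕ}
    {Z : ℕ → Ω → 𝒵} (hZ : ∀ t ≤ T, Measurable (Z t)) {p : (t : ℕ) → Kernel (Fin t → 𝒵) 𝒵}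
    [∀ t, IsMarkovKernel (p t)] (hp : IsDistributedAccordingTo μ Z p T)
    {ℱ : Set (𝒵 → ℝ)} (hℱ : IsMeasurableClass ℱ) {M : ℝ} (hM0 : 0 < M)
    (hf0 : ∀ f ∈ ℱ, ∀ z, 0 ≤ f z) (hM : ∀ f ∈ ℱ, ∀ z, |f z| ≤ M) {w : Fin T → ℝ}
    (hw : 0 < l2norm w) {β : ℝ} (hβ : 0 ≤ β) {N δ : ℝ} (hδ : 0 < δ) (hδ1 : δ < 1) (hN : 1 ≤ N)
    (hcov : expectedCoveringNumber p w β ℱ ≤ ENNReal.ofReal N) :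
    μ {ω | ∃ f ∈ ℱ, 2 * β + M * l2norm w * √(2 * Real.log (2 * N / δ)) ≤
        ∑ t, w t * (condMean p Z f t ω - f (Z t ω))} ≤ ENNReal.ofReal δ := by
  rcases ℱ.eq_empty_or_nonempty with rfl | hne
  · simp
  set L := Real.log (2 * N / δ) with hL
  have hratio : 1 < 2 * N / δ := by
    rw [one_lt_div hδ]
    linarith
  have hLpos : 0 < L := Real.log_pos hratio
  set r := √(2 * L) with hr
  have hrpos : 0 < r := Real.sqrt_pos.2 (by positivity)
  have hr2 : r ^ 2 = 2 * L := Real.sq_sqrt (by positivity)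
  have hW2 : ∑ t, w t ^ 2 = l2norm w ^ 2 :=
    (Real.sq_sqrt (Finset.sum_nonneg fun t _ => sq_nonneg _)).symm
  set W := l2norm w
  -- This minimises `c ^ 2 * M ^ 2 * W ^ 2 / 2 - c * M * W * r`, with minimum `-r ^ 2 / 2 = -L`.
  let c := r / (M * W)
  have hc : 0 < c := by positivity
  have hcM : c * (M * W) = r := div_mul_cancel₀ _ (by positivity)
  have hB : ∀ g ∈ ((fun (f : 𝒵 → ℝ) x => f x - M / 2) '' ℱ), ∀ z, |g z| ≤ M / 2 := by
    rintro _ ⟨f, hf, rfl⟩ z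
    have h1 := hf0 f hf z
    have h2 := (abs_le.1 (hM f hf z)).2
    exact abs_le.2 ⟨by simp only; linarith, by simp only; linarith⟩
  have key := measure_exists_deviation_mul_exp_le μ hZ hp (hℱ.sub_const hne hM (M / 2))
    (by positivity) hB w hc hβ (2 * β + M * W * r)
  have hset : {ω | ∃ f ∈ ℱ, 2 * β + M * W * r ≤ ∑ t, w t * (condMean p Z f t ω - f (Z t ω))} ⊆
      {ω | ∃ g ∈ ((fun (f : 𝒵 → ℝ) x => f x - M / 2) '' ℱ), 2 * β + M * W * r ≤
        ∑ t, w t * (condMean p Z g t ω - g (Z t ω))} := by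
    rintro ω ⟨f, hf, h⟩
    refine ⟨_, ⟨f, hf, rfl⟩, h.trans (le_of_eq ?_)⟩
    refine Finset.sum_congr rfl fun t _ => ?_
    rw [condMean_sub_const p Z (hℱ.1 f hf) (hM f hf)]
    ring
  refine (measure_mono hset).trans ?_
  rw [← ENNReal.mul_le_mul_iff_right (a := ENNReal.ofReal (Real.exp (c * (2 * β + M * W * r))))
    (by simpa using Real.exp_pos _) ENNReal.ofReal_ne_top]
  refine key.trans ((mul_le_mul' le_rfl
    ((expectedCoveringNumber_sub_const_le p w β ℱ (M / 2)).trans hcov)).trans ?_)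
  rw [← ENNReal.ofReal_mul (Real.exp_pos _).le, ← ENNReal.ofReal_mul (Real.exp_pos _).le]
  refine ENNReal.ofReal_le_ofReal ?_
  have e1 : 2 * c * β + (2 * c) ^ 2 * (M / 2) ^ 2 / 2 * ∑ t, w t ^ 2 = 2 * c * β + L := by
    rw [hW2]
    have : (2 * c) ^ 2 * (M / 2) ^ 2 / 2 * W ^ 2 = (c * (M * W)) ^ 2 / 2 := by ring
    rw [this, hcM, hr2]
    ring
  have e2 : c * (2 * β + M * W * r) = 2 * c * β + L + L := by
    have : c * (2 * β + M * W * r) = 2 * c * β + c * (M * W) * r := by ring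
    rw [this, hcM, ← sq, hr2]
    ring
  rw [e1, e2, Real.exp_add (2 * c * β + L), mul_assoc (Real.exp _)]
  refine mul_le_mul_of_nonneg_left ?_ (Real.exp_pos _).le
  -- What remains is `N ≤ 2 * N`: the factor 2 in the logarithm is slack.
  rw [hL, Real.exp_log (by positivity), div_mul_cancel₀ _ hδ.ne']
  linarith

/-- Bounds that hold with probability `1 - δ` for each level in a set of levels hold for all levels
simultaneously, since the exceptional sets are nested. -/
lemma exists_measurableSet_forall_le {μ : Measure Ω} [IsProbabilityMeasure μ] {ι : Sort*}
    (X : ι → Ω → ℝ) {R : Set ℝ} (hR : BddBelow R) {δ : ℝ} (hδ : 0 ≤ δ)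
    (h : ∀ r ∈ R, μ {ω | ∃ i, r ≤ X i ω} ≤ ENNReal.ofReal δ) :
    ∃ S : Set Ω, MeasurableSet S ∧ 1 - δ ≤ μ.real S ∧ ∀ ω ∈ S, ∀ i, ∀ r ∈ R, X i ω ≤ r := by
  rcases R.eq_empty_or_nonempty with rfl | hne
  · exact ⟨Set.univ, MeasurableSet.univ, by simpa using hδ, by simp⟩
  -- The infimum of the levels need not be attained, so it is approached from above. The events
  -- increase with `k`, and continuity from below preserves the bound `δ`.
  let A : Set Ω := ⋃ k : ℕ, {ω | ∃ i, sInf R + 1 / ((k : ℝ) + 1) ≤ X i ω}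
  have hA : μ A ≤ ENNReal.ofReal δ := by
    rw [Directed.measure_iUnion]
    · refine iSup_le fun k => ?_
      obtain ⟨r, hr, hlt⟩ := exists_lt_of_csInf_lt hne
        (lt_add_of_pos_right (sInf R) (Nat.one_div_pos_of_nat (α := ℝ) (n := k)))
      refine (measure_mono ?_).trans (h r hr)
      rintro ω ⟨i, hi⟩
      exact ⟨i, hlt.le.trans hi⟩
    · refine Monotone.directed_le fun k l hkl => ?_
      rintro ω ⟨i, hi⟩
      exact ⟨i, le_trans (add_le_add le_rfl (Nat.one_div_le_one_div hkl)) hi⟩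
  -- Events over an arbitrary index type need not be measurable; a measurable hull has the same
  -- measure.
  refine ⟨(toMeasurable μ A)ᶜ, (measurableSet_toMeasurable μ A).compl, ?_, fun ω hω i r hr => ?_⟩
  · rw [probReal_compl_eq_one_sub (measurableSet_toMeasurable μ A), measureReal_def,
      measure_toMeasurable]
    exact sub_le_sub_left (ENNReal.toReal_le_of_le_ofReal hδ hA) 1
  · by_contra! hlt
    have h1 : sInf R < X i ω := (csInf_le hR hr).trans_lt hlt
    obtain ⟨k, hk⟩ := exists_nat_one_div_lt (sub_pos.2 h1)
    exact hω (subset_toMeasurable μ A (Set.mem_iUnion.2 ⟨k, i, by linarith⟩))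

lemma norm_le_two_mul_max {T : ℕ} (q w : Fin T → ℝ) : ‖w‖ ≤ 2 * max ‖q‖ ‖q - w‖ := by
  have h := norm_sub_le q (q - w)
  rw [sub_sub_cancel] at h
  linarith [le_max_left ‖q‖ ‖q - w‖, le_max_right ‖q‖ ‖q - w‖]

/-- A cover for the larger one of the weights `q` and `q - w` is a cover for `w`, at twice the
scale. -/
lemma expectedCoveringNumber_le_max (p : (t : ℕ) → Kernel (Fin t → 𝒵) 𝒵) {T : ℕ}
    (q w : Fin T → ℝ) (α : ℝ) (𝒢 : Set (𝒵 → ℝ)) :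
    expectedCoveringNumber p w (2 * α) 𝒢 ≤
      max (expectedCoveringNumber p q α 𝒢) (expectedCoveringNumber p (q - w) α 𝒢) := by
  have h := norm_le_two_mul_max q w
  rcases max_cases ‖q‖ ‖q - w‖ with ⟨e, -⟩ | ⟨e, -⟩ <;> rw [e] at h
  · exact (expectedCoveringNumber_mono_weight p zero_le_two h le_rfl 𝒢).trans (le_max_left _ _)
  · exact (expectedCoveringNumber_mono_weight p zero_le_two h le_rfl 𝒢).trans (le_max_right _ _)

/-- The forecasting error is controlled by the discrepancies and the deviation of the weighted
sums from their conditional means. -/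
lemma condMean_le_discrepancies (p : (t : ℕ) → Kernel (Fin t → 𝒵) 𝒵) [∀ t, IsMarkovKernel (p t)]
    {Ω : Type*} (Z : ℕ → Ω → 𝒵) {ℱ : Set (𝒵 → ℝ)} {M : ℝ} (hM : ∀ f ∈ ℱ, ∀ z, |f z| ≤ M) {T : ℕ}
    (s : ℕ) (q : Fin T → ℝ) {f : 𝒵 → ℝ} (hf : f ∈ ℱ) (ω : Ω) :
    condMean p Z f T ω ≤ ∑ t : Fin T, q t * f (Z t ω) + empiricalDisc Z ℱ s q ω +
      discLast p Z ℱ T s ω +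
      ∑ t, lastUniform T s t * (condMean p Z f t ω - f (Z t ω)) := by
  have h1 : ∑ t : Fin T, (lastUniform T s t - q t) * f (Z t ω) ≤ empiricalDisc Z ℱ s q ω :=
    le_ciSup (bddAbove_sum hM (fun t => lastUniform T s t - q t) fun t : Fin T => Z t ω) ⟨f, hf⟩
  have hb : BddAbove (Set.range fun f : ℱ =>
      condMean p Z f.1 T ω - ∑ t : Fin T, lastUniform T s t * condMean p Z f.1 t ω) := by
    refine ⟨M + ∑ t : Fin T, |lastUniform T s t| * M, ?_⟩
    rintro _ ⟨g, rfl⟩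
    refine (le_abs_self _).trans ((abs_sub _ _).trans (add_le_add
      (abs_condMean_le p Z (hM _ g.2) _ _)
      (abs_sum_mul_le _ _ fun t => abs_condMean_le p Z (hM _ g.2) _ _)))
  have h2 : condMean p Z f T ω - ∑ t : Fin T, lastUniform T s t * condMean p Z f t ω ≤
      discLast p Z ℱ T s ω := le_ciSup hb ⟨f, hf⟩
  simp only [sub_mul, mul_sub, Finset.sum_sub_distrib] at h1 ⊢
  linarith

end Forecasting

end Forecast

/-! ### The corollary -/

theorem corollary10
    {Ω 𝒳 𝒴 : Type*} [MeasurableSpace Ω] [MeasurableSpace 𝒳] [MeasurableSpace 𝒴]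
    -- the process, with conditional distributions `p`
    (μ : Measure Ω) [IsProbabilityMeasure μ] (T : ℕ)
    (Z : ℕ → Ω → 𝒳 × 𝒴) (hZ : ∀ t ≤ T, Measurable (Z t))
    (p : (t : ℕ) → Kernel (Fin t → 𝒳 × 𝒴) (𝒳 × 𝒴)) [∀ t, IsMarkovKernel (p t)]
    (hp : Forecast.IsDistributedAccordingTo μ Z p T)
    -- the bounded loss and the hypothesis set
    (L : 𝒴 → 𝒴 → ℝ) (hL : ∀ y y', 0 ≤ L y y') (H : Set (𝒳 → 𝒴))
    (hmeas : Forecast.IsMeasurableClass (Forecast.lossClass L H))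
    (M : ℝ) (hM : ∀ f ∈ Forecast.lossClass L H, ∀ z, |f z| ≤ M)
    -- the weights, the length of the window and the confidence level
    (q : Fin T → ℝ) (s : ℕ) (hs : 1 ≤ s) (hsT : s ≤ T) (δ : ℝ) (hδ : 0 < δ) :
    ∃ S : Set Ω, MeasurableSet S ∧ 1 - δ ≤ μ.real S ∧
      ∀ ω ∈ S, ∀ f ∈ Forecast.lossClass L H, ∀ α : ℝ, 0 < α →
        ∀ N : ENNReal,
          N = max (Forecast.expectedCoveringNumber p q α (Forecast.lossClass L H))
            (Forecast.expectedCoveringNumber p (q - Forecast.lastUniform T s) α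
              (Forecast.lossClass L H)) →
          -- the bound is `+∞` when the expected covering number is infinite
          N ≠ ⊤ →
          Forecast.condMean p Z f T ω ≤
            ∑ t : Fin T, q t * f (Z t ω)
              + Forecast.empiricalDisc Z (Forecast.lossClass L H) s q ω
              + Forecast.discLast p Z (Forecast.lossClass L H) T s ω
              + 4 * α
              + M * (Forecast.l2norm q + Forecast.l2norm (q - Forecast.lastUniform T s))
                * √(2 * Real.log (2 * N.toReal / δ)) := by

  obtain ⟨ω₀⟩ := μ.nonempty_of_neZero
  set ℱ := Forecast.lossClass L H
  set w := Forecast.lastUniform T s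
  rcases le_or_gt 1 δ with hδ1 | hδ1
  · exact ⟨∅, MeasurableSet.empty, by simpa using hδ1, by simp⟩
  rcases ℱ.eq_empty_or_nonempty with he | hne
  · exact ⟨Set.univ, MeasurableSet.univ, by simpa using hδ.le, by simp [he]⟩
  have hM0 : 0 ≤ M := (abs_nonneg _).trans (hM _ hne.some_mem (Z 0 ω₀))
  have hf0 : ∀ f ∈ ℱ, ∀ z, 0 ≤ f z := by
    rintro _ ⟨h, -, rfl⟩ z
    exact hL _ _
  let N : ℝ → ENNReal := fun α => max (Forecast.expectedCoveringNumber p q α ℱ)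
    (Forecast.expectedCoveringNumber p (q - w) α ℱ)
  let r : ℝ → ℝ := fun α =>
    4 * α + M * Forecast.l2norm w * √(2 * Real.log (2 * (N α).toReal / δ))
  have hW := Forecast.l2norm_lastUniform_pos hs hsT
  have hdev : ∃ S : Set Ω, MeasurableSet S ∧ 1 - δ ≤ μ.real S ∧ ∀ ω ∈ S, ∀ f : ℱ,
      ∀ x ∈ r '' {α | 0 < α ∧ N α ≠ ⊤},
        ∑ t, w t * (Forecast.condMean p Z f.1 t ω - f.1 (Z t ω)) ≤ x := by
    have hr0 : ∀ x ∈ r '' {α | 0 < α ∧ N α ≠ ⊤}, 0 ≤ x := by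
      rintro _ ⟨α, ⟨hα, -⟩, rfl⟩
      positivity
    -- For `M = 0` the Chernoff parameter would divide by zero, but then every `f` vanishes.
    rcases hM0.eq_or_lt with rfl | hMpos
    · refine ⟨Set.univ, MeasurableSet.univ, by simpa using hδ.le, fun ω _ f x hx => ?_⟩
      have hz : f.1 = 0 := funext fun z => abs_nonpos_iff.1 (hM f.1 f.2 z)
      simpa [hz, Forecast.condMean] using hr0 x hx
    · refine Forecast.exists_measurableSet_forall_le
        (fun (f : ℱ) ω => ∑ t, w t * (Forecast.condMean p Z f.1 t ω - f.1 (Z t ω)))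
        ⟨0, hr0⟩ hδ.le ?_
      rintro _ ⟨α, ⟨hα, hN⟩, rfl⟩
      have hN1 : 1 ≤ (N α).toReal := by
        rw [← ENNReal.toReal_one, ENNReal.toReal_le_toReal ENNReal.one_ne_top hN]
        exact (Forecast.one_le_expectedCoveringNumber p q α hne).trans (le_max_left _ _)
      -- The cover for `w` has scale `2 * α`, and symmetrization doubles it again: this is the term
      -- `4 * α`.
      have h := Forecast.measure_exists_deviation_le μ hZ hp hmeas hMpos hf0 hM hW
        (β := 2 * α) (by positivity) hδ hδ1 hN1
        ((Forecast.expectedCoveringNumber_le_max p q w α ℱ).trans (ENNReal.ofReal_toReal hN).ge)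
      have e : r α =
          2 * (2 * α) + M * Forecast.l2norm w * √(2 * Real.log (2 * (N α).toReal / δ)) := by
        simp only [r]
        ring
      simpa only [e, Subtype.exists, exists_prop] using h
  obtain ⟨S, hSm, hSμ, hS⟩ := hdev
  refine ⟨S, hSm, hSμ, fun ω hω f hf α hα N' hN' hfin => ?_⟩
  subst hN'
  have h1 := hS ω hω ⟨f, hf⟩ (r α) ⟨α, ⟨hα, hfin⟩, rfl⟩
  have h2 := Forecast.condMean_le_discrepancies p Z hM s q hf ω
  have h3 : M * Forecast.l2norm w * √(2 * Real.log (2 * (N α).toReal / δ)) ≤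
      M * (Forecast.l2norm q + Forecast.l2norm (q - w)) *
        √(2 * Real.log (2 * (N α).toReal / δ)) := by
    gcongr
    exact Forecast.l2norm_le_add q w
  simp only [r, N] at h1 h3
  linarith
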